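/- **Conventions.** Let $d_1,d_2,D\ge 1$ be integers. $|\cdot|$ is the Euclidean norm and $B_N(0)$ the open Euclidean ball. A *gauge function* is a strictly increasing continuous function $q:[0,r)\to\mathbb{R}_+$ ($0<r\le\infty$) with $q(0)=0$; we put $q^{-1}(\tau)=\sup\{x\in[0,r): q(x)\le\tau\}$, which is the usual inverse on the range of $q$ (and equals $r$ above the range). For a kernel $\mathfrak g:\mathbb{R}^D\to[0,\infty]$ and a Borel set $A\subset\mathbb{R}^D$, $$\mathrm{Cap}_{\mathfrak g}(A)=\Big[\inf_{\mu}\int_{\mathbb{R}^D\times\mathbb{R}^D}\mathfrak g(y-\bar y)\,\mu(dy)\mu(d\bar y)\Big]^{-1},$$ the infimum being over all Borel probability measures $\mu$ with $\mu(\mathbb{R}^D\setminus A)=0$ (so $\mathrm{Cap}_{\mathfrak g}(\emptyset)=0$). **Setting.** Let $I\subset\mathbb{R}^{d_1}$, $J\subset\mathbb{R}^{d_2}$ be compact sets of positive Lebesgue measure, with diameters $d_I,d_J$. Let $q_1,q_2$ be gauge functions whose domains contain $d_I$, $d_J$ respectively, let $c_{I,J}=\max(q_1(d_I),q_2(d_J))$,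 and suppose that $c_{I,J}$ lies in the range of both $q_1$ and $q_2$. Suppose that $q_i$ is differentiable on $(0,q_i^{-1}(c_{I,J}))$ and that $\dot q_i$ is decreasing (not necessarily strictly) on $(0,c_{I,J})\cap(0,q_i^{-1}(c_{I,J}))$, $i=1,2$. Define $$\bar g_q(\tau)=\frac{\tau^D}{(q_1^{-1}(\tau))^{d_1}(q_2^{-1}(\tau))^{d_2}}\ (\tau>0),\qquad \bar v_q(\tau)=\int_\tau^{c_{I,J}}\frac{\rho^{1-D}\,[q_1^{-1}(\rho)]^{d_1-1}[q_2^{-1}(\rho)]^{d_2-1}}{\dot q_1(q_1^{-1}(\rho))\,\dot q_2(q_2^{-1}(\rho))}\,d\rho\in[0,\infty],$$ and let $(\bar g_q)^{-1}$ denote the kernel $z\mapsto 1/\bar g_q(|z|)$ for $z\ne0$, with value $\infty$ at $z=0$. Suppose that $$\sup_{\tau\in(0,c_{I,J}]}\bar v_q(\tau/2)\,\bar g_q(\tau)\in(0,\infty).$$ Let $N>0$, let $f:\mathbb{R}^{d_1}\times\mathbb{R}^{d_2}\to\mathbb{R}^D$, and let $c_1,c_2,c_3,\eta,k_1,k_2,k_3>0$.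 **Theorem.** There is a constant $C>0$, depending only on $f$, $I$, $J$, $N$, $d_1$, $d_2$, $D$, $q_1$, $q_2$ and the constants $c_1,c_2,c_3,\eta,k_1,k_2,k_3$, such that the following holds. Let $U=\{U(t,x)=(U_1(t,x),\dots,U_D(t,x)):(t,x)\in\mathbb{R}^{d_1}\times\mathbb{R}^{d_2}\}$ be a Gaussian process on a probability space, with i.i.d. components, whose sample paths are almost surely continuous on $I\times J$, with $E\,U(t,x)=f(t,x)$ on $I\times J$; write $\tilde U=U-f$, and suppose that $(H_U)$ holds, that is, for all $(t,x),(s,y)\in I\times J$: 1. $c_1\le \mathrm{Var}\,U_1(t,x)\le c_2$; 2. $\mathrm{Corr}(U_1(t,x),U_1(s,y))<1$ if $(t,x)\ne(s,y)$; 3. $|\mathrm{Var}\,U_1(t,x)-\mathrm{Var}\,U_1(s,y)|\le c_3\,\|U_1(t,x)-U_1(s,y)\|_{L^2(\Omega)}^{1+\eta}$; 4. $k_1\,(q_1(|t-s|)+q_2(|x-y|))\le\|\tilde U_1(t,x)-\tilde U_1(s,y)\|_{L^2(\Omega)}\le k_2\,(q_1(|t-s|)+q_2(|x-y|))$ and $|f(t,x)-f(s,y)|\le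 k_3\,(q_1(|t-s|)+q_2(|x-y|))$. Then, for every Borel set $A\subset B_N(0)\subset\mathbb{R}^D$, $$P\{U(I\times J)\cap A\ne\emptyset\}\ \ge\ C\,\mathrm{Cap}_{(\bar g_q)^{-1}}(A).$$ -/

import Mathlib

open MeasureTheory ProbabilityTheory
open scoped ENNReal

noncomputable section

/-! ### Energy and capacity -/

/-- The energy of a measure `μ` relative to a potential kernel `k`. -/
def kernelEnergy {E : Type*} [MeasurableSpace E] [Sub E] (k : E → ℝ≥0∞) (μ : Measure E) : ℝ≥0∞ :=
  ∫⁻ z, k (z.1 - z.2) ∂(μ.prod μ)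

/-- The capacity of a Borel set `A` relative to a potential kernel `k`: the inverse of the infimum
of the energies of the probability measures on `A` (so the empty set has capacity `0`). -/
def kernelCapacity {E : Type*} [MeasurableSpace E] [Sub E] (k : E → ℝ≥0∞) (A : Set E) : ℝ≥0∞ :=
  (⨅ (μ : Measure E) (_ : IsProbabilityMeasure μ) (_ : μ Aᶜ = 0), kernelEnergy k μ)⁻¹

/-! ### Gauge functions -/

/-- The interval `[0, r)`, where `0 < r ≤ ∞`. -/
def gaugeDomain (r : ℝ≥0∞) : Set ℝ := {x | 0 ≤ x ∧ ENNReal.ofReal x < r}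

/-- `q` is a gauge function on `[0, r)`: strictly increasing, continuous, `q 0 = 0`.
The values of `q` outside `[0, r)` are irrelevant. -/
structure IsGauge (q : ℝ → ℝ) (r : ℝ≥0∞) : Prop where
  pos : 0 < r
  zero : q 0 = 0
  strictMonoOn : StrictMonoOn q (gaugeDomain r)
  continuousOn : ContinuousOn q (gaugeDomain r)

/-- The inverse `q⁻¹(τ)` of a gauge function on `[0, r)`. For `τ` in the range of `q` this is the
unique `x` with `q x = τ`; for `τ ≥ 0` above the range it is `r`. -/
def gaugeInv (q : ℝ → ℝ) (r : ℝ≥0∞) (τ : ℝ) : ℝ≥0∞ :=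
  ⨆ x ∈ {x ∈ gaugeDomain r | q x ≤ τ}, ENNReal.ofReal x

/-- `ḡ_q(τ) = τ ^ D / (q₁⁻¹(τ) ^ d₁ * q₂⁻¹(τ) ^ d₂)` (to be used for `τ > 0`). -/
def gBar (d₁ d₂ D : ℕ) (q₁ q₂ : ℝ → ℝ) (r₁ r₂ : ℝ≥0∞) (τ : ℝ) : ℝ≥0∞ :=
  ENNReal.ofReal τ ^ D / (gaugeInv q₁ r₁ τ ^ d₁ * gaugeInv q₂ r₂ τ ^ d₂)

/-- The potential kernel `z ↦ (ḡ_q(|z|))⁻¹` on `ℝ^D`, with the value `∞` at the origin. -/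
def gBarKernel (d₁ d₂ D : ℕ) (q₁ q₂ : ℝ → ℝ) (r₁ r₂ : ℝ≥0∞) (z : EuclideanSpace ℝ (Fin D)) :
    ℝ≥0∞ :=
  open Classical in if z = 0 then ⊤ else (gBar d₁ d₂ D q₁ q₂ r₁ r₂ ‖z‖)⁻¹

/-- The function `v̄_q(τ)`, with upper limit of integration `c`: the integral over `ρ ∈ (τ, c)` of
`ρ ^ (1 - D) * q₁⁻¹(ρ) ^ (d₁ - 1) * q₂⁻¹(ρ) ^ (d₂ - 1) / (q₁'(q₁⁻¹(ρ)) * q₂'(q₂⁻¹(ρ)))`. -/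
def vBar (d₁ d₂ D : ℕ) (q₁ q₂ : ℝ → ℝ) (r₁ r₂ : ℝ≥0∞) (c τ : ℝ) : ℝ≥0∞ :=
  ∫⁻ ρ in Set.Ioo τ c,
    ENNReal.ofReal (ρ ^ (1 - (D : ℤ))) * gaugeInv q₁ r₁ ρ ^ (d₁ - 1) * gaugeInv q₂ r₂ ρ ^ (d₂ - 1) *
      (ENNReal.ofReal (deriv q₁ (gaugeInv q₁ r₁ ρ).toReal))⁻¹ *
      (ENNReal.ofReal (deriv q₂ (gaugeInv q₂ r₂ ρ).toReal))⁻¹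

/-! ### Gaussian random fields -/

/-- `U` is an `ℝ^D`-valued Gaussian process indexed by `T`, with i.i.d. components
(the components are regarded as processes, that is, as random elements of `T → ℝ`). -/
structure IsIIDGaussianField {Ω T : Type*} [MeasurableSpace Ω] {D : ℕ}
    (U : T → Ω → EuclideanSpace ℝ (Fin D)) (P : Measure Ω) : Prop where
  measurable : ∀ p, Measurable (U p)
  gaussian : IsGaussianProcess U P
  indep : iIndepFun (fun (j : Fin D) (ω : Ω) (p : T) => U p ω j) P
  ident : ∀ i j : Fin D,
    IdentDistrib (fun (ω : Ω) (p : T) => U p ω i) (fun (ω : Ω) (p : T) => U p ω j) P P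

/-- The correlation coefficient of two real random variables. -/
def corr {Ω : Type*} [MeasurableSpace Ω] (X Y : Ω → ℝ) (P : Measure Ω) : ℝ :=
  cov[X, Y; P] / (√Var[X; P] * √Var[Y; P])

/-- Hypotheses `(H_U)` on the set `S = I × J`, for a random field `U` with mean function `f`,
with all the constants made explicit. -/
structure HypU {Ω : Type*} [MeasurableSpace Ω] {d₁ d₂ D : ℕ} [NeZero D]
    (S : Set (EuclideanSpace ℝ (Fin d₁) × EuclideanSpace ℝ (Fin d₂)))
    (U : EuclideanSpace ℝ (Fin d₁) × EuclideanSpace ℝ (Fin d₂) → Ω → EuclideanSpace ℝ (Fin D))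
    (P : Measure Ω)
    (f : EuclideanSpace ℝ (Fin d₁) × EuclideanSpace ℝ (Fin d₂) → EuclideanSpace ℝ (Fin D))
    (q₁ q₂ : ℝ → ℝ) (c₁ c₂ c₃ η k₁ k₂ k₃ : ℝ) : Prop where
  mean : ∀ p ∈ S, ∫ ω, U p ω ∂P = f p
  var_lower : ∀ p ∈ S, c₁ ≤ Var[fun ω => U p ω 0; P]
  var_upper : ∀ p ∈ S, Var[fun ω => U p ω 0; P] ≤ c₂
  corr_lt_one : ∀ p ∈ S, ∀ p' ∈ S, p ≠ p' →
    corr (fun ω => U p ω 0) (fun ω => U p' ω 0) P < 1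
  var_sub : ∀ p ∈ S, ∀ p' ∈ S,
    |Var[fun ω => U p ω 0; P] - Var[fun ω => U p' ω 0; P]| ≤
      c₃ * lpNorm (fun ω => U p ω 0 - U p' ω 0) 2 P ^ (1 + η)
  metric_lower : ∀ p ∈ S, ∀ p' ∈ S,
    k₁ * (q₁ ‖p.1 - p'.1‖ + q₂ ‖p.2 - p'.2‖) ≤
      lpNorm (fun ω => (U p ω 0 - f p 0) - (U p' ω 0 - f p' 0)) 2 P
  metric_upper : ∀ p ∈ S, ∀ p' ∈ S,
    lpNorm (fun ω => (U p ω 0 - f p 0) - (U p' ω 0 - f p' 0)) 2 P ≤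
      k₂ * (q₁ ‖p.1 - p'.1‖ + q₂ ‖p.2 - p'.2‖)
  mean_sub : ∀ p ∈ S, ∀ p' ∈ S,
    ‖f p - f p'‖ ≤ k₃ * (q₁ ‖p.1 - p'.1‖ + q₂ ‖p.2 - p'.2‖)

end

/-! The proof is a second moment argument. Let `K ⊆ A` be compact, `μ` a measure on `K` of finite
energy, `S = I' × J'` a small compact part of `I × J` of positive volume, and let `Z_ε` be the
(volume on `S`) ⊗ `μ` measure of the pairs `(p, z)` with `|U_j(p) - z_j| ≤ ε` for all `j`. A lower
bound on Gaussian densities gives `E Z_ε ≥ c ε^D`, and Cauchy–Schwarz bounds `P(Z_ε ≠ 0)` below by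
`(E Z_ε)² / E Z_ε²`. If `E Z_ε² ≤ C ε^(2D) · energy(μ)`, this bound does not depend on `ε`; if `Z_ε
≠ 0` for arbitrarily small `ε`, compactness makes `U(S)` meet `K` (`hitting_lower_bound`).

The second moment rests on two estimates. Write `Δ = q₁(|t - s|) + q₂(|x - y|)`, which is comparable
to the canonical distance. In `exists_measure_two_point_le`, the probability that `U(p)`, `U(p')`
are `ε`-close to `z`, `z'` is at most `C ε^(2D) max(|z - z'|, Δ)^(-D)`: the residual of the
regression of one value on the other is independent of it and has standard deviation of order `Δ`,
so each coordinate contributes `1/Δ`, and Gaussian decay takes over when `|z - z'|` is large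
compared with `Δ`.

In `exists_localization`, the integral of `max(a, Δ)^(-D)` over `p' ∈ S` is at most `const /
ḡ_q(a)`. Indeed `b^(-D)` is controlled by an integral of `ρ^(-D-1)`, the sets `{Δ < ρ}` have volume
at most of order `q₁⁻¹(ρ)^d₁ q₂⁻¹(ρ)^d₂`, and concavity, `q_i⁻¹(ρ) ≤ ρ / q_i'(q_i⁻¹(ρ))`, turns the
result into `v̄_q(a)`; the growth condition then applies. -/

/-! ### Gauge functions and their inverses. -/

section Gauge

variable {q : ℝ → ℝ} {r : ℝ≥0∞}

theorem mem_gaugeDomain_of_le {x y : ℝ} (hx : x ∈ gaugeDomain r) (hy : 0 ≤ y) (hyx : y ≤ x) :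
    y ∈ gaugeDomain r :=
  ⟨hy, (ENNReal.ofReal_le_ofReal hyx).trans_lt hx.2⟩

theorem zero_mem_gaugeDomain (hr : 0 < r) : (0 : ℝ) ∈ gaugeDomain r := ⟨le_rfl, by simpa using hr⟩

theorem le_gaugeInv {x τ : ℝ} (hx : x ∈ gaugeDomain r) (h : q x ≤ τ) :
    ENNReal.ofReal x ≤ gaugeInv q r τ :=
  le_iSup₂_of_le x ⟨hx, h⟩ le_rfl

theorem gaugeInv_mono {τ τ' : ℝ} (h : τ ≤ τ') : gaugeInv q r τ ≤ gaugeInv q r τ' :=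
  iSup₂_le fun _ hx => le_gaugeInv hx.1 (hx.2.trans h)

theorem IsGauge.gaugeInv_apply (hq : IsGauge q r) {x : ℝ} (hx : x ∈ gaugeDomain r) :
    gaugeInv q r (q x) = ENNReal.ofReal x := by
  refine le_antisymm (iSup₂_le fun y hy => ?_) (le_gaugeInv hx le_rfl)
  exact ENNReal.ofReal_le_ofReal ((hq.strictMonoOn.le_iff_le hy.1 hx).1 hy.2)

theorem IsGauge.nonneg (hq : IsGauge q r) {x : ℝ} (hx : x ∈ gaugeDomain r) : 0 ≤ q x := by
  rw [← hq.zero]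
  exact hq.strictMonoOn.monotoneOn (zero_mem_gaugeDomain hq.pos) hx hx.1

theorem IsGauge.apply_pos (hq : IsGauge q r) {x : ℝ} (hx : x ∈ gaugeDomain r) (h : 0 < x) :
    0 < q x := by
  rw [← hq.zero]
  exact hq.strictMonoOn (zero_mem_gaugeDomain hq.pos) hx h

/-- The values of a gauge function are small near the origin. -/
theorem IsGauge.exists_small (hq : IsGauge q r) {b τ : ℝ} (hb : 0 < b) (hτ : 0 < τ) :
    ∃ x, 0 < x ∧ x < b ∧ x ∈ gaugeDomain r ∧ q x < τ := by
  have h1 : ∀ᶠ x in nhdsWithin 0 (Set.Ioi 0), x < b ∧ x ∈ gaugeDomain r := by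
    have h2 : ∀ᶠ x : ℝ in nhds 0, ENNReal.ofReal x < r :=
      (ENNReal.continuous_ofReal.tendsto 0).eventually_lt_const (by simpa using hq.pos)
    filter_upwards [nhdsWithin_le_nhds h2, nhdsWithin_le_nhds (gt_mem_nhds hb),
      self_mem_nhdsWithin] with x h3 h4 h5
    exact ⟨h4, le_of_lt h5, h3⟩
  have h2 : Filter.Tendsto q (nhdsWithin 0 (Set.Ioi 0)) (nhds 0) := by
    have h3 := hq.continuousOn 0 (zero_mem_gaugeDomain hq.pos)
    rw [ContinuousWithinAt, hq.zero] at h3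
    exact h3.mono_left (le_inf nhdsWithin_le_nhds (Filter.le_principal_iff.2 (h1.mono fun _ h => h.2)))
  obtain ⟨x, h3, h4, h5⟩ := (h1.and ((h2.eventually_lt_const hτ).and self_mem_nhdsWithin)).exists
  exact ⟨x, h5, h3.1, h3.2, h4⟩

theorem IsGauge.gaugeInv_pos (hq : IsGauge q r) {τ : ℝ} (hτ : 0 < τ) : 0 < gaugeInv q r τ := by
  obtain ⟨x, h1, -, h2, h3⟩ := hq.exists_small one_pos hτ
  exact (ENNReal.ofReal_pos.2 h1).trans_le (le_gaugeInv h2 h3.le)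

theorem IsGauge.exists_eq (hq : IsGauge q r) {b τ : ℝ} (hb : b ∈ gaugeDomain r) (hτ : 0 ≤ τ)
    (hτb : τ ≤ q b) : ∃ x, x ∈ gaugeDomain r ∧ x ≤ b ∧ q x = τ := by
  have hsub : Set.Icc 0 b ⊆ gaugeDomain r := fun x hx => mem_gaugeDomain_of_le hb hx.1 hx.2
  obtain ⟨x, hx, rfl⟩ := intermediate_value_Icc hb.1 (hq.continuousOn.mono hsub)
    (show τ ∈ Set.Icc (q 0) (q b) by rw [hq.zero]; exact ⟨hτ, hτb⟩)
  exact ⟨x, hsub hx, hx.2, rfl⟩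

/-- Concavity of the gauge function bounds its inverse by the derivative of the inverse. -/
theorem IsGauge.gaugeInv_le_mul (hq : IsGauge q r) {b c ρ : ℝ} (hb : b ∈ gaugeDomain r)
    (hbc : b < c) (hqb : q b < c) (hρ : 0 < ρ) (hρb : ρ ≤ q b)
    (hdiff : ∀ x ∈ gaugeDomain r, 0 < x → q x < c → DifferentiableAt ℝ q x)
    (hanti : AntitoneOn (deriv q) {x ∈ gaugeDomain r | 0 < x ∧ x < c ∧ q x < c}) :
    gaugeInv q r ρ ≤
      ENNReal.ofReal ρ * (ENNReal.ofReal (deriv q (gaugeInv q r ρ).toReal))⁻¹ := by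
  obtain ⟨x, hx, hxb, rfl⟩ := hq.exists_eq hb hρ.le hρb
  rw [hq.gaugeInv_apply hx, ENNReal.toReal_ofReal hx.1]
  have hx0 : 0 < x := by
    rcases hx.1.eq_or_lt with h | h
    · rw [← h, hq.zero] at hρ; exact absurd hρ (lt_irrefl _)
    · exact h
  have hmem : ∀ y, 0 < y → y ≤ x → y ∈ {x ∈ gaugeDomain r | 0 < x ∧ x < c ∧ q x < c} := by
    intro y h0 hy
    have hd := mem_gaugeDomain_of_le hx h0.le hy
    exact ⟨hd, h0, by linarith, ((hq.strictMonoOn.monotoneOn hd hx hy).trans hρb).trans_lt hqb⟩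
  -- Mean value theorem on `[0, x]`: `q x / x = q'(ξ) ≥ q'(x)`, since the derivative decreases.
  obtain ⟨ξ, hξ, hs⟩ := exists_deriv_eq_slope q hx0
    (hq.continuousOn.mono fun y hy => mem_gaugeDomain_of_le hx hy.1 hy.2)
    (fun y hy => (hdiff y (hmem y hy.1 hy.2.le).1 hy.1
      (hmem y hy.1 hy.2.le).2.2.2).differentiableWithinAt)
  have h1 := hanti (hmem ξ hξ.1 hξ.2.le) (hmem x hx0 le_rfl) hξ.2.le
  rw [hs, hq.zero, sub_zero, sub_zero, le_div_iff₀ hx0] at h1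
  rw [← div_eq_mul_inv, ENNReal.le_div_iff_mul_le (Or.inr (by simpa using hρ))
    (Or.inl ENNReal.ofReal_ne_top), ← ENNReal.ofReal_mul hx.1]
  exact ENNReal.ofReal_le_ofReal (by linarith)

end Gauge

/-! ### Integrals of negative powers of the gauge distance, bounded by `vBar`. -/

/-- A negative power is dominated by an integral over a dyadic interval. -/
theorem inv_pow_le_lintegral_Ioo (D : ℕ) {b : ℝ} (hb : 0 < b) :
    (ENNReal.ofReal b ^ D)⁻¹ ≤
      2 ^ (D + 1) * ∫⁻ ρ in Set.Ioo b (2 * b), (ENNReal.ofReal ρ ^ (D + 1))⁻¹ := by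
  -- The integrand is at least `(2b)^(-(D+1))` on an interval of length `b`; the factor `2^(D+1)`
  -- restores `b^(-D)`.
  have h1 : ∫⁻ _ in Set.Ioo b (2 * b), (ENNReal.ofReal (2 * b) ^ (D + 1))⁻¹ ≤
      ∫⁻ ρ in Set.Ioo b (2 * b), (ENNReal.ofReal ρ ^ (D + 1))⁻¹ := by
    refine setLIntegral_mono' measurableSet_Ioo fun ρ hρ => ?_
    gcongr
    exact hρ.2.le
  refine le_trans (le_of_eq ?_) (mul_le_mul_right h1 _)
  rw [setLIntegral_const, Real.volume_Ioo, ← ENNReal.ofReal_pow (by positivity),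
    ← ENNReal.ofReal_pow (by positivity), ← ENNReal.ofReal_inv_of_pos (by positivity),
    ← ENNReal.ofReal_inv_of_pos (by positivity), show (2 : ℝ≥0∞) = ENNReal.ofReal 2 by simp,
    ← ENNReal.ofReal_pow (by positivity), ← ENNReal.ofReal_mul (by positivity),
    ← ENNReal.ofReal_mul (by positivity)]
  congr 1
  field_simp
  ring

/-- Nothing is known of `q` outside its domain. Clamping the argument to `[0, δ]` yields a monotone,
hence measurable, function, as Tonelli requires. -/
theorem measurable_clamp_gauge {q : ℝ → ℝ} {r : ℝ≥0∞} (hq : IsGauge q r) {δ : ℝ}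
    (hδ : δ ∈ gaugeDomain r) : Measurable fun x => q (max 0 (min x δ)) := by
  refine Monotone.measurable fun x y hxy => hq.strictMonoOn.monotoneOn
    (mem_gaugeDomain_of_le hδ (le_max_left _ _) (max_le hδ.1 (min_le_right _ _)))
    (mem_gaugeDomain_of_le hδ (le_max_left _ _) (max_le hδ.1 (min_le_right _ _))) (by gcongr)

theorem volume_closedBall_gaugeInv_le {d : ℕ} {q : ℝ → ℝ} {r : ℝ≥0∞} (hq : IsGauge q r)
    {δ ρ : ℝ} (hδ : δ ∈ gaugeDomain r) (hρ : 0 ≤ ρ) (hρδ : ρ ≤ q δ)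
    (t : EuclideanSpace ℝ (Fin d)) :
    volume {s | ‖t - s‖ ≤ δ ∧ q (max 0 (min ‖t - s‖ δ)) ≤ ρ} ≤
      gaugeInv q r ρ ^ d * volume (Metric.closedBall (0 : EuclideanSpace ℝ (Fin d)) 1) := by
  obtain ⟨x, hx, -, rfl⟩ := hq.exists_eq hδ hρ hρδ
  rw [hq.gaugeInv_apply hx]
  calc _ ≤ volume (Metric.closedBall t x) := by
        refine measure_mono fun s hs => ?_
        have h1 : ‖t - s‖ ∈ gaugeDomain r := mem_gaugeDomain_of_le hδ (norm_nonneg _) hs.1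
        have h2 := hs.2
        rw [min_eq_left hs.1, max_eq_right (norm_nonneg _), hq.strictMonoOn.le_iff_le h1 hx] at h2
        rwa [Metric.mem_closedBall, dist_comm, dist_eq_norm]
    _ = _ := by
        rw [Measure.addHaar_closedBall' _ _ hx.1]
        simp [ENNReal.ofReal_pow hx.1]

/-- The integrand of `vBar` dominates the volume of small balls. -/
theorem vBar_integrand_ge {d₁ d₂ D : ℕ} [NeZero d₁] [NeZero d₂] {ρ : ℝ} (hρ : 0 < ρ)
    {G₁ G₂ i₁ i₂ : ℝ≥0∞} (h₁ : G₁ ≤ ENNReal.ofReal ρ * i₁) (h₂ : G₂ ≤ ENNReal.ofReal ρ * i₂) :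
    (ENNReal.ofReal ρ ^ (D + 1))⁻¹ * (G₁ ^ d₁ * G₂ ^ d₂) ≤
      ENNReal.ofReal (ρ ^ (1 - (D : ℤ))) * G₁ ^ (d₁ - 1) * G₂ ^ (d₂ - 1) * i₁ * i₂ := by
  have e1 : ENNReal.ofReal (ρ ^ (1 - (D : ℤ))) =
      (ENNReal.ofReal ρ ^ (D + 1))⁻¹ * ENNReal.ofReal ρ * ENNReal.ofReal ρ := by
    rw [← ENNReal.ofReal_pow hρ.le, ← ENNReal.ofReal_inv_of_pos (by positivity),
      ← ENNReal.ofReal_mul (by positivity), ← ENNReal.ofReal_mul (by positivity)]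
    congr 1
    rw [zpow_sub₀ hρ.ne', zpow_one, zpow_natCast]
    field_simp
    ring
  have e2 : ∀ (d : ℕ) [NeZero d] (G : ℝ≥0∞), G ^ d = G ^ (d - 1) * G := fun d _ G => by
    rw [← pow_succ, Nat.sub_add_cancel (NeZero.one_le)]
  rw [e1, e2 d₁, e2 d₂]
  calc _ ≤ (ENNReal.ofReal ρ ^ (D + 1))⁻¹ * (G₁ ^ (d₁ - 1) * (ENNReal.ofReal ρ * i₁) *
        (G₂ ^ (d₂ - 1) * (ENNReal.ofReal ρ * i₂))) := by gcongr
    _ = _ := by ring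

/-- A layer-cake argument: `b^(-D)` becomes an integral of `ρ^(-D-1)` over `(b, 2b)`, Tonelli
exchanges the integrals, and the inner one is the volume of a sublevel set. The smallness of `S`
keeps `2b ≤ 2u`, within the range of both gauges. -/
theorem lintegral_inv_pow_le_vBar {d₁ d₂ D : ℕ} [NeZero d₁] [NeZero d₂]
    {q₁ q₂ : ℝ → ℝ} {r₁ r₂ : ℝ≥0∞} (hq₁ : IsGauge q₁ r₁) (hq₂ : IsGauge q₂ r₂) {c δ u a : ℝ}
    (hdiff₁ : ∀ x ∈ gaugeDomain r₁, 0 < x → q₁ x < c → DifferentiableAt ℝ q₁ x)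
    (hdiff₂ : ∀ x ∈ gaugeDomain r₂, 0 < x → q₂ x < c → DifferentiableAt ℝ q₂ x)
    (hanti₁ : AntitoneOn (deriv q₁) {x ∈ gaugeDomain r₁ | 0 < x ∧ x < c ∧ q₁ x < c})
    (hanti₂ : AntitoneOn (deriv q₂) {x ∈ gaugeDomain r₂ | 0 < x ∧ x < c ∧ q₂ x < c})
    (hδ₁ : δ ∈ gaugeDomain r₁) (hδ₂ : δ ∈ gaugeDomain r₂) (hδ : δ < c)
    (hqδ₁ : q₁ δ < c) (hqδ₂ : q₂ δ < c) (hu₁ : 2 * u ≤ q₁ δ) (hu₂ : 2 * u ≤ q₂ δ)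
    {S : Set (EuclideanSpace ℝ (Fin d₁) × EuclideanSpace ℝ (Fin d₂))} (hS : MeasurableSet S)
    (hS₁ : ∀ p ∈ S, ∀ p' ∈ S, ‖p.1 - p'.1‖ ≤ δ ∧ q₁ ‖p.1 - p'.1‖ ≤ u)
    (hS₂ : ∀ p ∈ S, ∀ p' ∈ S, ‖p.2 - p'.2‖ ≤ δ ∧ q₂ ‖p.2 - p'.2‖ ≤ u)
    (ha : 0 < a) (hau : a ≤ u) {p : EuclideanSpace ℝ (Fin d₁) × EuclideanSpace ℝ (Fin d₂)}
    (hp : p ∈ S) :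
    ∫⁻ p' in S, (ENNReal.ofReal (max a (q₁ ‖p.1 - p'.1‖ + q₂ ‖p.2 - p'.2‖)) ^ D)⁻¹ ≤
      2 ^ (D + 1) * (volume (Metric.closedBall (0 : EuclideanSpace ℝ (Fin d₁)) 1) *
        volume (Metric.closedBall (0 : EuclideanSpace ℝ (Fin d₂)) 1)) *
        vBar d₁ d₂ D q₁ q₂ r₁ r₂ c a := by
  set qc₁ : ℝ → ℝ := fun x => q₁ (max 0 (min x δ)) with hqc₁
  set qc₂ : ℝ → ℝ := fun x => q₂ (max 0 (min x δ)) with hqc₂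
  have hm₁ : Measurable qc₁ := measurable_clamp_gauge hq₁ hδ₁
  have hm₂ : Measurable qc₂ := measurable_clamp_gauge hq₂ hδ₂
  -- A maximum in place of the sum: its sublevel sets lie in products of balls.
  set b : EuclideanSpace ℝ (Fin d₁) × EuclideanSpace ℝ (Fin d₂) → ℝ := fun p' =>
    max a (max (qc₁ ‖p.1 - p'.1‖) (qc₂ ‖p.2 - p'.2‖)) with hb
  have hbm : Measurable b := by fun_prop
  have hc1 : ∀ p' ∈ S, qc₁ ‖p.1 - p'.1‖ = q₁ ‖p.1 - p'.1‖ := fun p' hp' => by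
    simp only [hqc₁]
    rw [min_eq_left (hS₁ p hp p' hp').1, max_eq_right (norm_nonneg _)]
  have hc2 : ∀ p' ∈ S, qc₂ ‖p.2 - p'.2‖ = q₂ ‖p.2 - p'.2‖ := fun p' hp' => by
    simp only [hqc₂]
    rw [min_eq_left (hS₂ p hp p' hp').1, max_eq_right (norm_nonneg _)]
  set V₁ := volume (Metric.closedBall (0 : EuclideanSpace ℝ (Fin d₁)) 1)
  set V₂ := volume (Metric.closedBall (0 : EuclideanSpace ℝ (Fin d₂)) 1)
  set h : ℝ → ℝ≥0∞ := fun ρ => (ENNReal.ofReal ρ ^ (D + 1))⁻¹ with hh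
  have hhm : Measurable h := by fun_prop
  calc ∫⁻ p' in S, (ENNReal.ofReal (max a (q₁ ‖p.1 - p'.1‖ + q₂ ‖p.2 - p'.2‖)) ^ D)⁻¹
      ≤ ∫⁻ p' in S, 2 ^ (D + 1) *
          ∫⁻ ρ in Set.Ioo a (2 * u), (if b p' < ρ then h ρ else 0) := by
        refine setLIntegral_mono' hS fun p' hp' => ?_
        have h1 := hq₁.nonneg (mem_gaugeDomain_of_le hδ₁ (norm_nonneg _) (hS₁ p hp p' hp').1)
        have h2 := hq₂.nonneg (mem_gaugeDomain_of_le hδ₂ (norm_nonneg _) (hS₂ p hp p' hp').1)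
        have h3 : b p' ≤ max a (q₁ ‖p.1 - p'.1‖ + q₂ ‖p.2 - p'.2‖) := by
          simp only [hb, hc1 p' hp', hc2 p' hp']
          refine max_le_max le_rfl (max_le (by linarith) (by linarith))
        have h4 : b p' ≤ u := by
          simp only [hb, hc1 p' hp', hc2 p' hp']
          exact max_le hau (max_le (hS₁ p hp p' hp').2 (hS₂ p hp p' hp').2)
        have h5 : a ≤ b p' := le_max_left _ _
        calc _ ≤ (ENNReal.ofReal (b p') ^ D)⁻¹ := by gcongr
          _ ≤ _ := inv_pow_le_lintegral_Ioo D (ha.trans_le h5)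
          _ ≤ _ := by
            refine mul_le_mul_right ?_ _
            calc _ = ∫⁻ ρ in Set.Ioo (b p') (2 * b p'), (if b p' < ρ then h ρ else 0) :=
                  setLIntegral_congr_fun measurableSet_Ioo fun ρ hρ => by
                    simp only [hh, if_pos hρ.1]
              _ ≤ _ := lintegral_mono_set (Set.Ioo_subset_Ioo h5 (by linarith))
    _ = 2 ^ (D + 1) * ∫⁻ ρ in Set.Ioo a (2 * u),
          ∫⁻ p' in S, (if b p' < ρ then h ρ else 0) := by
        rw [lintegral_const_mul' _ _ (by simp), lintegral_lintegral_swap]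
        refine Measurable.aemeasurable (Measurable.ite ?_ (by fun_prop) measurable_const)
        exact measurableSet_lt (by fun_prop) (by fun_prop)
    _ ≤ 2 ^ (D + 1) * ∫⁻ ρ in Set.Ioo a c, V₁ * V₂ *
          (ENNReal.ofReal (ρ ^ (1 - (D : ℤ))) * gaugeInv q₁ r₁ ρ ^ (d₁ - 1) *
            gaugeInv q₂ r₂ ρ ^ (d₂ - 1) *
            (ENNReal.ofReal (deriv q₁ (gaugeInv q₁ r₁ ρ).toReal))⁻¹ *
            (ENNReal.ofReal (deriv q₂ (gaugeInv q₂ r₂ ρ).toReal))⁻¹) := by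
        refine mul_le_mul_right ?_ _
        refine (setLIntegral_mono' measurableSet_Ioo fun ρ hρ => ?_).trans
          (lintegral_mono_set (Set.Ioo_subset_Ioo_right (by linarith)))
        have hρ0 : 0 < ρ := ha.trans hρ.1
        have hρ1 : ρ ≤ q₁ δ := hρ.2.le.trans hu₁
        have hρ2 : ρ ≤ q₂ δ := hρ.2.le.trans hu₂
        calc ∫⁻ p' in S, (if b p' < ρ then h ρ else 0)
            = h ρ * volume ({p' | b p' < ρ} ∩ S) := by
              rw [← Measure.restrict_apply (measurableSet_lt hbm measurable_const),
                ← lintegral_indicator_const (measurableSet_lt hbm measurable_const)]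
              rfl
          _ ≤ h ρ * ((gaugeInv q₁ r₁ ρ ^ d₁ * V₁) * (gaugeInv q₂ r₂ ρ ^ d₂ * V₂)) := by
              gcongr
              refine le_trans (measure_mono (t := {s | ‖p.1 - s‖ ≤ δ ∧ qc₁ ‖p.1 - s‖ ≤ ρ} ×ˢ
                {s | ‖p.2 - s‖ ≤ δ ∧ qc₂ ‖p.2 - s‖ ≤ ρ}) ?_) ?_
              · rintro p' ⟨h1, h2⟩
                have h3 : b p' < ρ := h1
                simp only [hb, max_lt_iff] at h3
                exact ⟨⟨(hS₁ p hp p' h2).1, h3.2.1.le⟩, ⟨(hS₂ p hp p' h2).1, h3.2.2.le⟩⟩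
              · rw [Measure.volume_eq_prod, Measure.prod_prod]
                exact mul_le_mul' (volume_closedBall_gaugeInv_le hq₁ hδ₁ hρ0.le hρ1 _)
                  (volume_closedBall_gaugeInv_le hq₂ hδ₂ hρ0.le hρ2 _)
          _ = V₁ * V₂ * (h ρ * (gaugeInv q₁ r₁ ρ ^ d₁ * gaugeInv q₂ r₂ ρ ^ d₂)) := by ring
          _ ≤ _ := by
              refine mul_le_mul_right ?_ _
              exact vBar_integrand_ge hρ0
                (hq₁.gaugeInv_le_mul hδ₁ hδ hqδ₁ hρ0 hρ1 hdiff₁ hanti₁)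
                (hq₂.gaugeInv_le_mul hδ₂ hδ hqδ₂ hρ0 hρ2 hdiff₂ hanti₂)
    _ = _ := by
        rw [lintegral_const_mul', vBar, mul_assoc (2 ^ (D + 1))]
        exact ENNReal.mul_ne_top (measure_closedBall_lt_top.ne) (measure_closedBall_lt_top.ne)

theorem vBar_antitone {d₁ d₂ D : ℕ} {q₁ q₂ : ℝ → ℝ} {r₁ r₂ : ℝ≥0∞} {c τ τ' : ℝ} (h : τ ≤ τ') :
    vBar d₁ d₂ D q₁ q₂ r₁ r₂ c τ' ≤ vBar d₁ d₂ D q₁ q₂ r₁ r₂ c τ :=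
  lintegral_mono_set (Set.Ioo_subset_Ioo_left h)

/-! ### Localization to a small product of compact sets. -/

/-- A set of positive measure has a small compact part of positive measure. -/
theorem exists_small_compact {d : ℕ} {I : Set (EuclideanSpace ℝ (Fin d))} (hI : IsCompact I)
    (hvol : 0 < volume I) {δ : ℝ} (hδ : 0 < δ) :
    ∃ I' ⊆ I, IsCompact I' ∧ 0 < volume I' ∧ ∀ t ∈ I', ∀ s ∈ I', ‖t - s‖ ≤ δ := by
  obtain ⟨t₀, -, h⟩ := exists_mem_forall_mem_nhdsWithin_pos_measure hvol.ne'
  refine ⟨I ∩ Metric.closedBall t₀ (δ / 2), Set.inter_subset_left,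
    hI.inter_right Metric.isClosed_closedBall, h _ ?_, fun t ht s hs => ?_⟩
  · exact inter_mem_nhdsWithin I (Metric.closedBall_mem_nhds t₀ (by positivity))
  · rw [← dist_eq_norm]
    have := dist_triangle_right t s t₀
    linarith [Metric.mem_closedBall.1 ht.2, Metric.mem_closedBall.1 hs.2]

/-- For small `a` the growth condition converts `vBar` into `1 / gBar`. For `a` in `(u, N]` the
integrand is bounded and so is `gBar`, which matters because `N` may exceed `c`. -/
theorem exists_localization {d₁ d₂ D : ℕ} [NeZero d₁] [NeZero d₂]
    {I : Set (EuclideanSpace ℝ (Fin d₁))} {J : Set (EuclideanSpace ℝ (Fin d₂))}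
    (hI : IsCompact I) (hJ : IsCompact J) (hI_vol : 0 < volume I) (hJ_vol : 0 < volume J)
    {q₁ q₂ : ℝ → ℝ} {r₁ r₂ : ℝ≥0∞} (hq₁ : IsGauge q₁ r₁) (hq₂ : IsGauge q₂ r₂)
    {c : ℝ} (hc : 0 < c)
    (hc₁ : c ∈ q₁ '' gaugeDomain r₁) (hc₂ : c ∈ q₂ '' gaugeDomain r₂)
    (hdiff₁ : ∀ x ∈ gaugeDomain r₁, 0 < x → q₁ x < c → DifferentiableAt ℝ q₁ x)
    (hdiff₂ : ∀ x ∈ gaugeDomain r₂, 0 < x → q₂ x < c → DifferentiableAt ℝ q₂ x)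
    (hanti₁ : AntitoneOn (deriv q₁) {x ∈ gaugeDomain r₁ | 0 < x ∧ x < c ∧ q₁ x < c})
    (hanti₂ : AntitoneOn (deriv q₂) {x ∈ gaugeDomain r₂ | 0 < x ∧ x < c ∧ q₂ x < c})
    (hsup : (⨆ τ ∈ Set.Ioc 0 c,
      vBar d₁ d₂ D q₁ q₂ r₁ r₂ c (τ / 2) * gBar d₁ d₂ D q₁ q₂ r₁ r₂ τ) ≠ ⊤)
    {u₀ : ℝ} (hu₀ : 0 < u₀) (N : ℝ) :
    ∃ I' ⊆ I, ∃ J' ⊆ J, IsCompact I' ∧ IsCompact J' ∧ 0 < volume I' ∧ 0 < volume J' ∧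
      (∀ t ∈ I', ∀ s ∈ I', 0 ≤ q₁ ‖t - s‖ ∧ (t ≠ s → 0 < q₁ ‖t - s‖) ∧ q₁ ‖t - s‖ ≤ u₀) ∧
      (∀ x ∈ J', ∀ y ∈ J', 0 ≤ q₂ ‖x - y‖ ∧ (x ≠ y → 0 < q₂ ‖x - y‖) ∧ q₂ ‖x - y‖ ≤ u₀) ∧
      ∃ K : ℝ≥0∞, K ≠ ⊤ ∧ ∀ p ∈ I' ×ˢ J', ∀ a, 0 < a → a ≤ N →
        ∫⁻ p' in I' ×ˢ J', (ENNReal.ofReal (max a (q₁ ‖p.1 - p'.1‖ + q₂ ‖p.2 - p'.2‖)) ^ D)⁻¹ ≤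
          K * (gBar d₁ d₂ D q₁ q₂ r₁ r₂ a)⁻¹ := by
  obtain ⟨x₁, hx₁, hqx₁⟩ := hc₁
  obtain ⟨x₂, hx₂, hqx₂⟩ := hc₂
  obtain ⟨δ₁, h10, h1c, h1d, h1q⟩ := hq₁.exists_small hc hc
  -- `δ` lies in both domains, below `c`, with both gauge values below `c`: the region where the
  -- derivatives are known to decrease.
  obtain ⟨δ, h20, h21, h2d, h2q⟩ := hq₂.exists_small h10 hc
  have hδ₁ : δ ∈ gaugeDomain r₁ := mem_gaugeDomain_of_le h1d h20.le h21.le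
  have hqδ₁ : q₁ δ < c := (hq₁.strictMonoOn.monotoneOn hδ₁ h1d h21.le).trans_lt h1q
  have hp₁ : 0 < q₁ δ := hq₁.apply_pos hδ₁ h20
  have hp₂ : 0 < q₂ δ := hq₂.apply_pos h2d h20
  obtain ⟨u, hu, huu₀, hu₁, hu₂⟩ : ∃ u, 0 < u ∧ u ≤ u₀ ∧ 2 * u ≤ q₁ δ ∧ 2 * u ≤ q₂ δ := by
    refine ⟨min u₀ (min (q₁ δ / 2) (q₂ δ / 2)), by positivity, min_le_left _ _, ?_, ?_⟩
    · have := (min_le_right u₀ (min (q₁ δ / 2) (q₂ δ / 2))).trans (min_le_left _ _)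
      linarith
    · have := (min_le_right u₀ (min (q₁ δ / 2) (q₂ δ / 2))).trans (min_le_right _ _)
      linarith
  obtain ⟨e₁, he₁, he₁δ, he₁d, he₁q⟩ := hq₁.exists_small h20 hu
  obtain ⟨e₂, he₂, he₂δ, he₂d, he₂q⟩ := hq₂.exists_small h20 hu
  obtain ⟨I', hI'I, hI'c, hI'v, hI's⟩ := exists_small_compact hI hI_vol he₁
  obtain ⟨J', hJ'J, hJ'c, hJ'v, hJ's⟩ := exists_small_compact hJ hJ_vol he₂
  have hqI : ∀ t ∈ I', ∀ s ∈ I', ‖t - s‖ ∈ gaugeDomain r₁ ∧ q₁ ‖t - s‖ ≤ u := fun t ht s hs => by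
    have := mem_gaugeDomain_of_le he₁d (norm_nonneg _) (hI's t ht s hs)
    exact ⟨this, (hq₁.strictMonoOn.monotoneOn this he₁d (hI's t ht s hs)).trans he₁q.le⟩
  have hqJ : ∀ t ∈ J', ∀ s ∈ J', ‖t - s‖ ∈ gaugeDomain r₂ ∧ q₂ ‖t - s‖ ≤ u := fun t ht s hs => by
    have := mem_gaugeDomain_of_le he₂d (norm_nonneg _) (hJ's t ht s hs)
    exact ⟨this, (hq₂.strictMonoOn.monotoneOn this he₂d (hJ's t ht s hs)).trans he₂q.le⟩
  refine ⟨I', hI'I, J', hJ'J, hI'c, hJ'c, hI'v, hJ'v, fun t ht s hs => ⟨hq₁.nonneg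
    (hqI t ht s hs).1, fun hne => hq₁.apply_pos (hqI t ht s hs).1 (norm_sub_pos_iff.2 hne),
    (hqI t ht s hs).2.trans huu₀⟩, fun t ht s hs => ⟨hq₂.nonneg
    (hqJ t ht s hs).1, fun hne => hq₂.apply_pos (hqJ t ht s hs).1 (norm_sub_pos_iff.2 hne),
    (hqJ t ht s hs).2.trans huu₀⟩, ?_⟩
  set L := ⨆ τ ∈ Set.Ioc 0 c, vBar d₁ d₂ D q₁ q₂ r₁ r₂ c (τ / 2) * gBar d₁ d₂ D q₁ q₂ r₁ r₂ τ
  set V := volume (Metric.closedBall (0 : EuclideanSpace ℝ (Fin d₁)) 1) *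
        volume (Metric.closedBall (0 : EuclideanSpace ℝ (Fin d₂)) 1) with hV
  have hVtop : V ≠ ⊤ :=
    ENNReal.mul_ne_top measure_closedBall_lt_top.ne measure_closedBall_lt_top.ne
  have hIJ : IsCompact (I' ×ˢ J') := hI'c.prod hJ'c
  set G := gaugeInv q₁ r₁ u ^ d₁ * gaugeInv q₂ r₂ u ^ d₂ with hG
  have hG0 : G ≠ 0 :=
    mul_ne_zero (pow_ne_zero _ (hq₁.gaugeInv_pos hu).ne') (pow_ne_zero _ (hq₂.gaugeInv_pos hu).ne')
  set K₁ := 2 ^ (D + 1) * V * L with hK₁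
  set K₂ := (ENNReal.ofReal u ^ D)⁻¹ * volume (I' ×ˢ J') * (ENNReal.ofReal N ^ D * G⁻¹) with hK₂
  have hK₁top : K₁ ≠ ⊤ := ENNReal.mul_ne_top (ENNReal.mul_ne_top (by simp) hVtop) hsup
  have hu0 : ENNReal.ofReal u ^ D ≠ 0 := pow_ne_zero _ (by simpa using hu)
  have hK₂top : K₂ ≠ ⊤ := ENNReal.mul_ne_top (ENNReal.mul_ne_top (ENNReal.inv_ne_top.2 hu0)
    hIJ.measure_lt_top.ne) (ENNReal.mul_ne_top (by simp) (ENNReal.inv_ne_top.2 hG0))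
  refine ⟨K₁ + K₂, ENNReal.add_ne_top.2 ⟨hK₁top, hK₂top⟩, fun p hp a ha haN => ?_⟩
  rcases le_or_gt a u with hau | hau
  · have hS : ∀ p ∈ I' ×ˢ J', ∀ p' ∈ I' ×ˢ J', ‖p.1 - p'.1‖ ≤ δ ∧ q₁ ‖p.1 - p'.1‖ ≤ u :=
      fun p hp p' hp' => ⟨(hI's _ hp.1 _ hp'.1).trans he₁δ.le, (hqI _ hp.1 _ hp'.1).2⟩
    have hS' : ∀ p ∈ I' ×ˢ J', ∀ p' ∈ I' ×ˢ J', ‖p.2 - p'.2‖ ≤ δ ∧ q₂ ‖p.2 - p'.2‖ ≤ u :=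
      fun p hp p' hp' => ⟨(hJ's _ hp.2 _ hp'.2).trans he₂δ.le, (hqJ _ hp.2 _ hp'.2).2⟩
    have hac : a ≤ c := by linarith
    have h1 := lintegral_inv_pow_le_vBar (D := D) hq₁ hq₂ hdiff₁ hdiff₂ hanti₁ hanti₂ hδ₁ h2d
      (h21.trans h1c) hqδ₁ h2q hu₁ hu₂ hIJ.measurableSet hS hS' ha hau hp
    have h2 : vBar d₁ d₂ D q₁ q₂ r₁ r₂ c (a / 2) * gBar d₁ d₂ D q₁ q₂ r₁ r₂ a ≤ L :=
      le_iSup₂_of_le a ⟨ha, hac⟩ le_rfl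
    -- Since `c` is in the range of the gauges, their inverses are finite up to `c`. Hence `gBar a`
    -- is neither `0` nor `∞` and one may divide by it.
    have h3 : gaugeInv q₁ r₁ a ≠ ⊤ := ne_top_of_le_ne_top ENNReal.ofReal_ne_top
      ((gaugeInv_mono hac).trans_eq (hqx₁ ▸ hq₁.gaugeInv_apply hx₁))
    have h4 : gaugeInv q₂ r₂ a ≠ ⊤ := ne_top_of_le_ne_top ENNReal.ofReal_ne_top
      ((gaugeInv_mono hac).trans_eq (hqx₂ ▸ hq₂.gaugeInv_apply hx₂))
    have h5 : gBar d₁ d₂ D q₁ q₂ r₁ r₂ a ≠ 0 := by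
      rw [gBar]
      exact ENNReal.div_ne_zero.2 ⟨pow_ne_zero _ (by simpa using ha),
        ENNReal.mul_ne_top (ENNReal.pow_ne_top h3) (ENNReal.pow_ne_top h4)⟩
    have h6 : gBar d₁ d₂ D q₁ q₂ r₁ r₂ a ≠ ⊤ := by
      rw [gBar]
      exact ENNReal.div_ne_top (by simp) (mul_ne_zero
        (pow_ne_zero _ (hq₁.gaugeInv_pos ha).ne') (pow_ne_zero _ (hq₂.gaugeInv_pos ha).ne'))
    rw [← ENNReal.le_div_iff_mul_le (Or.inl h5) (Or.inl h6)] at h2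
    calc _ ≤ _ := h1
      _ ≤ 2 ^ (D + 1) * V * (L / gBar d₁ d₂ D q₁ q₂ r₁ r₂ a) := by
        gcongr
        exact (vBar_antitone (by linarith)).trans h2
      _ = K₁ * (gBar d₁ d₂ D q₁ q₂ r₁ r₂ a)⁻¹ := by rw [hK₁, div_eq_mul_inv, mul_assoc]; ring
      _ ≤ _ := by gcongr; exact le_self_add
  · calc _ ≤ ∫⁻ _ in I' ×ˢ J', (ENNReal.ofReal u ^ D)⁻¹ := by
          refine lintegral_mono fun p' => ?_
          have : u ≤ max a (q₁ ‖p.1 - p'.1‖ + q₂ ‖p.2 - p'.2‖) := hau.le.trans (le_max_left _ _)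
          gcongr
      _ = (ENNReal.ofReal u ^ D)⁻¹ * volume (I' ×ˢ J') * 1 := by rw [setLIntegral_const, mul_one]
      _ ≤ (ENNReal.ofReal u ^ D)⁻¹ * volume (I' ×ˢ J') * ((ENNReal.ofReal N ^ D * G⁻¹) *
            (gBar d₁ d₂ D q₁ q₂ r₁ r₂ a)⁻¹) := by
          gcongr
          have h1 : gBar d₁ d₂ D q₁ q₂ r₁ r₂ a ≤ ENNReal.ofReal N ^ D * G⁻¹ := by
            rw [gBar, div_eq_mul_inv, hG]
            have := gaugeInv_mono (q := q₁) (r := r₁) hau.le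
            have := gaugeInv_mono (q := q₂) (r := r₂) hau.le
            gcongr
          have h2 : ENNReal.ofReal N ^ D * G⁻¹ ≠ 0 := mul_ne_zero
            (pow_ne_zero _ (by simpa using ha.trans_le haN))
            (ENNReal.inv_ne_zero.2 (ENNReal.mul_ne_top (ENNReal.pow_ne_top ?_)
              (ENNReal.pow_ne_top ?_)))
          · rw [← ENNReal.mul_inv_cancel h2 (ENNReal.mul_ne_top (by simp)
              (ENNReal.inv_ne_top.2 hG0))]
            gcongr
          · exact ne_top_of_le_ne_top ENNReal.ofReal_ne_top ((gaugeInv_mono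
              (by linarith : u ≤ c)).trans_eq (hqx₁ ▸ hq₁.gaugeInv_apply hx₁))
          · exact ne_top_of_le_ne_top ENNReal.ofReal_ne_top ((gaugeInv_mono
              (by linarith : u ≤ c)).trans_eq (hqx₂ ▸ hq₂.gaugeInv_apply hx₂))
      _ = K₂ * (gBar d₁ d₂ D q₁ q₂ r₁ r₂ a)⁻¹ := by rw [hK₂]; ring
      _ ≤ _ := by gcongr; exact le_add_self

/-! ### One-dimensional Gaussian estimates. -/

theorem gaussianReal_Icc_le {m : ℝ} {v : NNReal} (hv : v ≠ 0) {z ε B : ℝ}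
    (hB : ∀ x, |x - z| ≤ ε → gaussianPDFReal m v x ≤ B) :
    gaussianReal m v {x | |x - z| ≤ ε} ≤ ENNReal.ofReal B * ENNReal.ofReal (2 * ε) := by
  have hset : {x : ℝ | |x - z| ≤ ε} = Metric.closedBall z ε := by
    ext x; simp [Real.dist_eq]
  rw [gaussianReal_apply _ hv, hset, ← Real.volume_closedBall z, ← setLIntegral_const]
  refine setLIntegral_mono' Metric.isClosed_closedBall.measurableSet fun x hx => ?_
  exact ENNReal.ofReal_le_ofReal (hB x (by rwa [Metric.mem_closedBall, Real.dist_eq] at hx))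

theorem le_gaussianReal_Icc {m : ℝ} {v : NNReal} (hv : v ≠ 0) {z ε B : ℝ}
    (hB : ∀ x, |x - z| ≤ ε → B ≤ gaussianPDFReal m v x) :
    ENNReal.ofReal B * ENNReal.ofReal (2 * ε) ≤ gaussianReal m v {x | |x - z| ≤ ε} := by
  have hset : {x : ℝ | |x - z| ≤ ε} = Metric.closedBall z ε := by
    ext x; simp [Real.dist_eq]
  rw [gaussianReal_apply _ hv, hset, ← Real.volume_closedBall z, ← setLIntegral_const]
  refine setLIntegral_mono' Metric.isClosed_closedBall.measurableSet fun x hx => ?_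
  exact ENNReal.ofReal_le_ofReal (hB x (by rwa [Metric.mem_closedBall, Real.dist_eq] at hx))

theorem inv_sqrt_two_pi_mul_le {v : ℝ} (hv : 0 < v) : (√(2 * Real.pi * v))⁻¹ ≤ (√v)⁻¹ := by
  have : (0 : ℝ) < √v := Real.sqrt_pos.2 hv
  gcongr
  nlinarith [Real.pi_gt_three]

theorem gaussianPDFReal_le {m x : ℝ} {v : NNReal} (hv : v ≠ 0) :
    gaussianPDFReal m v x ≤ (√(v : ℝ))⁻¹ := by
  have hv' : (0 : ℝ) < v := by positivity
  rw [gaussianPDFReal]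
  refine (mul_le_of_le_one_right (by positivity) ?_).trans (inv_sqrt_two_pi_mul_le hv')
  rw [Real.exp_le_one_iff, neg_div]
  exact neg_nonpos.2 (by positivity)

/-- Combine `y^D ≤ 1 + y^(2D)` with `t^D / D! ≤ exp t` at `t = y² / 2`. -/
theorem pow_mul_exp_neg_sq_le (D : ℕ) (y : ℝ) :
    y ^ D * Real.exp (-(y ^ 2 / 2)) ≤ 1 + 2 ^ D * D.factorial := by
  have h1 := Real.pow_div_factorial_le_exp (y ^ 2 / 2) (by positivity) D
  have h2 := Real.one_le_exp (show 0 ≤ y ^ 2 / 2 by positivity)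
  rw [Real.exp_neg, ← div_eq_mul_inv, div_le_iff₀ (Real.exp_pos _)]
  have hf : (0 : ℝ) < D.factorial := by positivity
  have h3 : y ^ (2 * D) ≤ 2 ^ D * D.factorial * Real.exp (y ^ 2 / 2) := by
    rw [div_le_iff₀ hf, div_pow, div_le_iff₀ (by positivity), ← pow_mul] at h1
    linarith
  have h4 : y ^ D ≤ 1 + y ^ (2 * D) := by
    rw [mul_comm, pow_mul]
    nlinarith [sq_nonneg (y ^ D - 1)]
  nlinarith

/-- Gaussian decay is traded for the power `D` exactly, so that one coordinate suffices to turn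
`Δ^(-D)` into `|z - z'|^(-D)`. -/
theorem gaussianPDFReal_le_tail (D : ℕ) {m x : ℝ} {v : NNReal} (hv : v ≠ 0) (hx : x ≠ m) :
    gaussianPDFReal m v x ≤
      (√(v : ℝ))⁻¹ * ((1 + 2 ^ D * D.factorial) * (√(v : ℝ) / |x - m|) ^ D) := by
  have hv' : (0 : ℝ) < v := by positivity
  have hs : (0 : ℝ) < √v := Real.sqrt_pos.2 hv'
  have hx' : 0 < |x - m| := abs_pos.2 (sub_ne_zero.2 hx)
  have h1 := pow_mul_exp_neg_sq_le D (|x - m| / √(v : ℝ))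
  rw [gaussianPDFReal]
  refine mul_le_mul (inv_sqrt_two_pi_mul_le hv') ?_ (Real.exp_pos _).le (by positivity)
  have h2 : -(x - m) ^ 2 / (2 * (v : ℝ)) = -((|x - m| / √(v : ℝ)) ^ 2 / 2) := by
    rw [div_pow, sq_abs, Real.sq_sqrt hv'.le]
    field_simp
  rw [h2]
  have h3 : (√(v : ℝ) / |x - m|) ^ D = ((|x - m| / √(v : ℝ)) ^ D)⁻¹ := by
    rw [← inv_pow, inv_div]
  rw [h3, ← div_eq_mul_inv, le_div_iff₀ (by positivity), mul_comm]
  exact h1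

/-! ### Nearly degenerate Gaussian pairs. -/

section Pair

variable {Ω : Type*} [MeasurableSpace Ω] {P : Measure Ω}

theorem HasGaussianLaw.measure_abs_sub_le_le {X : Ω → ℝ} (hX : HasGaussianLaw X P)
    (hv : 0 < Var[X; P]) (z ε : ℝ) :
    P {ω | |X ω - z| ≤ ε} ≤ ENNReal.ofReal (√Var[X; P])⁻¹ * ENNReal.ofReal (2 * ε) := by
  have hm : MeasurableSet {x : ℝ | |x - z| ≤ ε} := measurableSet_le (by fun_prop) (by fun_prop)
  have hv' : Var[X; P].toNNReal ≠ 0 := by simpa using hv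
  have := gaussianReal_Icc_le (m := P[X]) (z := z) (ε := ε) hv' fun x _ => gaussianPDFReal_le hv'
  rw [Real.coe_toNNReal _ hv.le] at this
  rwa [← hX.map_eq_gaussianReal, Measure.map_apply_of_aemeasurable hX.aemeasurable hm] at this

/-- The law of a Gaussian pair on a square, in terms of the residual of the regression. -/
theorem HasGaussianLaw.measure_square_le {X Y : Ω → ℝ}
    (h : HasGaussianLaw (fun ω => (X ω, Y ω)) P) (hA : 0 < Var[X; P])
    {β s z z' ε B : ℝ} (hβ : β = cov[X, Y; P] / Var[X; P]) (hs : s = Var[Y; P] - β * cov[X, Y; P])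
    (hs0 : 0 < s)
    (hB : ∀ x w, |x - z| ≤ ε → |w + β * x - z'| ≤ ε →
      gaussianPDFReal (P[Y] - β * P[X]) s.toNNReal w ≤ B) :
    P {ω | |X ω - z| ≤ ε ∧ |Y ω - z'| ≤ ε} ≤
      ENNReal.ofReal B * ENNReal.ofReal (2 * ε) *
        (ENNReal.ofReal (√Var[X; P])⁻¹ * ENNReal.ofReal (2 * ε)) := by
  have := h.isProbabilityMeasure
  have hX := h.fst
  have hY := h.snd
  have hX2 := hX.memLp_two
  have hY2 := hY.memLp_two
  -- The residual is uncorrelated with `X`, hence independent of it by joint normality; the law of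
  -- `(X, W)` is a product, and its slices over fixed `x` are intervals of half-length `ε`.
  set W : Ω → ℝ := fun ω => Y ω - β * X ω with hW
  have hXW : HasGaussianLaw (fun ω => (X ω, W ω)) P := by
    have := h.map_fun ((ContinuousLinearMap.fst ℝ ℝ ℝ).prod
      (ContinuousLinearMap.snd ℝ ℝ ℝ - β • ContinuousLinearMap.fst ℝ ℝ ℝ))
    simpa using this
  have hβX : MemLp (fun ω => β * X ω) 2 P := hX2.const_mul β
  have hcov : cov[X, W; P] = 0 := by
    have : W = Y - fun ω => β * X ω := rfl
    rw [this, covariance_sub_right hX2 hY2 hβX, covariance_const_mul_right,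
      covariance_self hX.aemeasurable, hβ]
    field_simp
    ring
  have hvar : Var[W; P] = s := by
    have : W = Y - fun ω => β * X ω := rfl
    rw [this, variance_sub hY2 hβX, covariance_const_mul_right, variance_const_mul, hs,
      covariance_comm Y X, hβ]
    field_simp
    ring
  have hmean : P[W] = P[Y] - β * P[X] := by
    rw [hW, integral_sub hY.integrable (hX.integrable.const_mul β), integral_const_mul]
  have hind := hXW.indepFun_of_covariance_eq_zero hcov
  have hprod := (indepFun_iff_map_prod_eq_prod_map_map hX.aemeasurable
    hXW.snd.aemeasurable).1 hind
  set T : Set (ℝ × ℝ) := {p | |p.1 - z| ≤ ε ∧ |p.2 + β * p.1 - z'| ≤ ε} with hT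
  have hTm : MeasurableSet T := by
    rw [hT, Set.ofPred_and]
    exact (measurableSet_le (by fun_prop) (by fun_prop)).inter
      (measurableSet_le (by fun_prop) (by fun_prop))
  have hE : P {ω | |X ω - z| ≤ ε ∧ |Y ω - z'| ≤ ε} = (P.map fun ω => (X ω, W ω)) T := by
    rw [Measure.map_apply_of_aemeasurable hXW.aemeasurable hTm]
    congr 1
    ext ω
    simp [hT, hW]
  have hm : MeasurableSet {x : ℝ | |x - z| ≤ ε} := measurableSet_le (by fun_prop) (by fun_prop)
  have := hXW.snd.isGaussian_map
  rw [hE, hprod, Measure.prod_apply hTm]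
  calc _ ≤ ∫⁻ x, {x : ℝ | |x - z| ≤ ε}.indicator
        (fun _ => ENNReal.ofReal B * ENNReal.ofReal (2 * ε)) x ∂(P.map X) := by
        refine lintegral_mono fun x => ?_
        by_cases hx : |x - z| ≤ ε
        · rw [Set.indicator_of_mem (by exact hx), hXW.snd.map_eq_gaussianReal, hmean, hvar]
          have hs' : s.toNNReal ≠ 0 := by simpa using hs0
          refine le_trans (measure_mono ?_) (gaussianReal_Icc_le hs' (z := z' - β * x) (ε := ε)
            fun w hw => hB x w hx ?_)
          · rintro w ⟨-, hw⟩
            simp only [Set.mem_ofPred_eq] at hw ⊢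
            rwa [show w - (z' - β * x) = w + β * x - z' by ring]
          · rwa [show w + β * x - z' = w - (z' - β * x) by ring]
        · have : Prod.mk x ⁻¹' T = ∅ := by
            ext w; simp [hT, hx]
          simp [this]
    _ = ENNReal.ofReal B * ENNReal.ofReal (2 * ε) * P {ω | |X ω - z| ≤ ε} := by
        rw [lintegral_indicator_const hm, Measure.map_apply_of_aemeasurable hX.aemeasurable hm]
        rfl
    _ ≤ _ := by
        gcongr
        exact HasGaussianLaw.measure_abs_sub_le_le hX hA z ε

end Pair

/-- The conditional variance of a nearly degenerate pair with variances `A`, `B` and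
covariance `K`. -/
theorem conditional_variance_bounds {A B K G a b : ℝ} (ha : 0 < a) (hA : a ≤ A) (hB : a ≤ B)
    (hAb : A ≤ b) (hG : G = A + B - 2 * K) (hG0 : 0 ≤ G) (hGa : G ≤ a)
    (hAB : (A - B) ^ 2 ≤ a * G) :
    a * G / (2 * b) ≤ B - K / A * K ∧ B - K / A * K ≤ G ∧ (1 - K / A) ^ 2 ≤ G / a := by
  have hA0 : 0 < A := ha.trans_le hA
  have hdet : a * G / 2 ≤ A * B - K ^ 2 := by
    -- Here `2(A + B)G ≥ 4aG`, while `G²` and `(A - B)²` are each at most `aG`.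
    have h4 : 4 * (A * B - K ^ 2) = 2 * (A + B) * G - G ^ 2 - (A - B) ^ 2 := by subst hG; ring
    nlinarith
  have e1 : B - K / A * K = (A * B - K ^ 2) / A := by field_simp
  have haG : 0 ≤ a * G := by positivity
  refine ⟨?_, ?_, ?_⟩
  · rw [e1, div_le_div_iff₀ (by linarith) hA0]
    nlinarith [mul_le_mul_of_nonneg_left hAb haG, mul_le_mul_of_nonneg_right hdet
      (show 0 ≤ 2 * b by linarith)]
  · rw [e1, div_le_iff₀ hA0]
    subst hG
    nlinarith [sq_nonneg (A - K)]
  · have e2 : (1 - K / A) ^ 2 = (A - K) ^ 2 / A ^ 2 := by field_simp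
    rw [e2, div_le_div_iff₀ (by positivity) ha]
    have h1 : (A - K) ^ 2 ≤ A * G := by subst hG; nlinarith
    calc (A - K) ^ 2 * a ≤ A * G * a := by gcongr
      _ ≤ A * G * A := by gcongr
      _ = G * A ^ 2 := by ring

/-- Joint density estimate for a Gaussian pair with canonical distance of order `Δ`. -/
theorem exists_measure_square_le (D : ℕ) {a b κ k l M R : ℝ} (ha : 0 < a) (hκ : 0 < κ)
    (hk : 0 < k) (hl : 0 ≤ l) (hM : 0 ≤ M) (hR : 0 ≤ R) :
    ∃ C : ℝ, 0 < C ∧ ∀ (Ω : Type*) [MeasurableSpace Ω] (P : Measure Ω) (X Y : Ω → ℝ)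
      (Δ ε z z' : ℝ), HasGaussianLaw (fun ω => (X ω, Y ω)) P → 0 < Δ → 0 < ε → ε ≤ 1 →
      a ≤ Var[X; P] → Var[X; P] ≤ b → a ≤ Var[Y; P] → Var[X - Y; P] ≤ a →
      (Var[X; P] - Var[Y; P]) ^ 2 ≤ a * Var[X - Y; P] →
      (κ * Δ) ^ 2 ≤ Var[X - Y; P] → Var[X - Y; P] ≤ (k * Δ) ^ 2 →
      |P[X]| ≤ M → |P[X] - P[Y]| ≤ l * Δ → |z| ≤ R →
      P {ω | |X ω - z| ≤ ε ∧ |Y ω - z'| ≤ ε} ≤ ENNReal.ofReal (C * ε ^ 2 / Δ) ∧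
      (4 * ε ≤ |z - z'| → P {ω | |X ω - z| ≤ ε ∧ |Y ω - z'| ≤ ε} ≤
        ENNReal.ofReal (C * ε ^ 2 / Δ * (Δ / |z - z'|) ^ D)) := by
  -- `κ' Δ` bounds the standard deviation of the residual from below; the maximum is there because
  -- `b` is not assumed positive.
  set κ' := √(a / (2 * max a b)) * κ with hκ'
  have hκ'0 : 0 < κ' := by have := ha.trans_le (le_max_left a b); positivity
  -- `L Δ` bounds the two shifts `(1 - β)(x - E X)` and `E X - E Y`, where `|x| ≤ R + 1`.
  set L := k / √a * (R + 1 + M) + l with hL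
  have hL0 : 0 < L := by positivity
  set F : ℝ := 1 + 2 ^ D * D.factorial with hF
  have hF0 : 0 < F := by positivity
  set C₀ := 4 / (√a * κ') with hC₀
  have hC₀0 : 0 < C₀ := by positivity
  refine ⟨C₀ * (1 + (4 * L) ^ D + F * (4 * k) ^ D), by positivity, ?_⟩
  intro Ω _ P X Y Δ ε z z' h hΔ hε hε1 hA hAb hB hGa hAB hG1 hG2 hX hXY hz
  have := h.isProbabilityMeasure
  have hA0 : 0 < Var[X; P] := ha.trans_le hA
  set β := cov[X, Y; P] / Var[X; P] with hβ
  set s := Var[Y; P] - β * cov[X, Y; P] with hs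
  obtain ⟨hs1, hs2, hs3⟩ := conditional_variance_bounds (K := cov[X, Y; P]) ha hA hB (hAb.trans (le_max_right a b))
    (show Var[X - Y; P] = _ by rw [variance_sub h.fst.memLp_two h.snd.memLp_two]; ring)
    (variance_nonneg _ _) hGa hAB
  change _ ≤ s at hs1
  change s ≤ _ at hs2
  change (1 - β) ^ 2 ≤ _ at hs3
  have hs4 : (κ' * Δ) ^ 2 ≤ s := by
    refine le_trans ?_ hs1
    have hab := ha.trans_le (le_max_left a b)
    rw [hκ', mul_assoc, mul_pow, Real.sq_sqrt (by positivity), mul_div_right_comm]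
    gcongr
  have hs0 : 0 < s := lt_of_lt_of_le (by positivity) hs4
  have hs5 : κ' * Δ ≤ √s := Real.le_sqrt_of_sq_le hs4
  have hs6 : √s ≤ k * Δ := Real.sqrt_le_iff.2 ⟨by positivity, hs2.trans hG2⟩
  have hs7 : (√s)⁻¹ ≤ (κ' * Δ)⁻¹ := by gcongr
  have hβ1 : |1 - β| ≤ k * Δ / √a := by
    refine abs_le_of_sq_le_sq ?_ (by positivity)
    rw [div_pow, Real.sq_sqrt ha.le]
    exact hs3.trans (by gcongr)
  have hsr : ((s.toNNReal : NNReal) : ℝ) = s := Real.coe_toNNReal _ hs0.le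
  have hsn : s.toNNReal ≠ 0 := by simpa using hs0
  have hgen : ∀ B : ℝ, 0 ≤ B → (∀ x w, |x - z| ≤ ε → |w + β * x - z'| ≤ ε →
      gaussianPDFReal (P[Y] - β * P[X]) s.toNNReal w ≤ (κ' * Δ)⁻¹ * B) →
      P {ω | |X ω - z| ≤ ε ∧ |Y ω - z'| ≤ ε} ≤ ENNReal.ofReal (C₀ * ε ^ 2 / Δ * B) := by
    intro B hB0 hB'
    refine (HasGaussianLaw.measure_square_le h hA0 hβ hs hs0 hB').trans ?_
    rw [← ENNReal.ofReal_mul (by positivity), ← ENNReal.ofReal_mul (by positivity),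
      ← ENNReal.ofReal_mul (by positivity)]
    refine ENNReal.ofReal_le_ofReal ?_
    have : (√Var[X; P])⁻¹ ≤ (√a)⁻¹ := by
      have := Real.sqrt_pos.2 ha
      gcongr
    calc _ ≤ (κ' * Δ)⁻¹ * B * (2 * ε) * ((√a)⁻¹ * (2 * ε)) := by gcongr
      _ = _ := by rw [hC₀]; field_simp; ring
  have hpdf1 : ∀ w, gaussianPDFReal (P[Y] - β * P[X]) s.toNNReal w ≤ (κ' * Δ)⁻¹ * 1 := by
    intro w
    rw [mul_one]
    refine (gaussianPDFReal_le hsn).trans ?_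
    rwa [hsr]
  have hb1 := hgen 1 zero_le_one fun _ w _ _ => hpdf1 w
  rw [mul_one] at hb1
  have hx0 : (0 : ℝ) ≤ (4 * L) ^ D := by positivity
  have hx1 : (0 : ℝ) ≤ F * (4 * k) ^ D := by positivity
  refine ⟨hb1.trans (ENNReal.ofReal_le_ofReal ?_), fun hzz => ?_⟩
  · gcongr
    exact le_mul_of_one_le_right hC₀0.le (by linarith)
  have hd : 0 < |z - z'| := by linarith
  -- If `|z - z'| ≤ 4LΔ`, the extra factor `(Δ / |z - z'|)^D` is bounded below and the crude bound
  -- suffices; otherwise the tail is used.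
  rcases le_or_gt |z - z'| (4 * L * Δ) with hc | hc
  · refine hb1.trans (ENNReal.ofReal_le_ofReal ?_)
    calc C₀ * ε ^ 2 / Δ = C₀ * ε ^ 2 / Δ * 1 := by ring
      _ ≤ C₀ * ε ^ 2 / Δ * ((4 * L * Δ) / |z - z'|) ^ D := by
        gcongr
        exact one_le_pow₀ ((one_le_div hd).2 hc)
      _ = C₀ * (4 * L) ^ D * ε ^ 2 / Δ * (Δ / |z - z'|) ^ D := by
        rw [mul_div_assoc (4 * L), mul_pow]; ring
      _ ≤ _ := by
        gcongr
        linarith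
  · refine (hgen (F * (4 * k * Δ / |z - z'|) ^ D) (by positivity) fun x w hx hw => ?_).trans
      (ENNReal.ofReal_le_ofReal ?_)
    · have hw4 : |z - z'| / 4 ≤ |w - (P[Y] - β * P[X])| := by
        have e : z - z' = (w + β * x - z') + (z - x) + (1 - β) * (x - P[X]) + (P[X] - P[Y])
            - (w - (P[Y] - β * P[X])) := by ring
        have h1 : |(1 - β) * (x - P[X])| ≤ k * Δ / √a * (R + 1 + M) := by
          rw [abs_mul]
          gcongr
          have := abs_sub x P[X]
          have := abs_sub_abs_le_abs_sub x z
          linarith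
        have h2 : |z - x| ≤ ε := by rwa [abs_sub_comm]
        have h3 : |z - z'| ≤ ε + ε + k * Δ / √a * (R + 1 + M) + l * Δ
            + |w - (P[Y] - β * P[X])| := by
          rw [e]
          refine (abs_sub _ _).trans (add_le_add_left ?_ _)
          refine (abs_add_le _ _).trans (add_le_add ?_ hXY)
          refine (abs_add_le _ _).trans (add_le_add ?_ h1)
          exact (abs_add_le _ _).trans (add_le_add hw h2)
        have h4 : k * Δ / √a * (R + 1 + M) + l * Δ = L * Δ := by rw [hL]; ring
        linarith
      have hwne : w ≠ P[Y] - β * P[X] := by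
        rintro rfl
        simp only [sub_self, abs_zero] at hw4
        linarith
      refine (gaussianPDFReal_le_tail D hsn hwne).trans ?_
      rw [hsr]
      have h5 : √s / |w - (P[Y] - β * P[X])| ≤ 4 * k * Δ / |z - z'| := by
        rw [show 4 * k * Δ / |z - z'| = k * Δ / (|z - z'| / 4) by field_simp]
        gcongr
      gcongr
    · calc _ = C₀ * (F * (4 * k) ^ D) * ε ^ 2 / Δ * (Δ / |z - z'|) ^ D := by
            rw [mul_div_assoc (4 * k), mul_pow]; ring
        _ ≤ _ := by
          gcongr
          linarith

/-! ### From `(H_U)` to the variances of coordinate pairs. -/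

theorem lpNorm_two_sq {Ω : Type*} [MeasurableSpace Ω] {P : Measure Ω} {Z : Ω → ℝ}
    (hZ : MemLp Z 2 P) : lpNorm Z 2 P ^ 2 = ∫ ω, Z ω ^ 2 ∂P := by
  rw [lpNorm_eq_integral_norm_rpow_toReal (by simp) (by simp) hZ.1]
  have h0 : 0 ≤ ∫ ω, Z ω ^ 2 ∂P := integral_nonneg fun ω => sq_nonneg _
  simp only [ENNReal.toReal_ofNat, Real.rpow_ofNat, Real.norm_eq_abs, sq_abs]
  rw [← Real.rpow_natCast, ← Real.rpow_mul h0]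
  simp

/-- Below a certain canonical distance the variances of two values are comparable. -/
theorem exists_small_distance {c₁ c₃ η k₁ k₂ k₃ : ℝ} (hc₁ : 0 < c₁) (hc₃ : 0 < c₃)
    (hη : 0 < η) (hk₁ : 0 < k₁) (hk₂ : 0 < k₂) (hk₃ : 0 < k₃) :
    ∃ u, 0 < u ∧ ∀ Δ, 0 ≤ Δ → Δ ≤ u →
      k₂ * Δ ≤ √c₁ ∧ c₃ * ((k₂ + k₃) * Δ) ^ (1 + η) ≤ √c₁ * (k₁ * Δ) := by
  have hs : 0 < √c₁ := Real.sqrt_pos.2 hc₁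
  set L := k₂ + k₃ with hL
  have hL0 : 0 < L := by positivity
  set t := √c₁ * k₁ / (c₃ * L) with ht
  have ht0 : 0 < t := by positivity
  -- The second bound gives `(LΔ)^η ≤ t`, so the power `1 + η` splits into a linear term and a small
  -- factor. It is `η > 0` that makes the variance difference negligible against the canonical
  -- distance.
  refine ⟨min (√c₁ / k₂) (t ^ (1 / η) / L), by positivity, fun Δ h0 hu => ⟨?_, ?_⟩⟩
  · have := hu.trans (min_le_left _ _)
    rwa [le_div_iff₀ hk₂, mul_comm] at this
  · have h1 := hu.trans (min_le_right _ _)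
    rw [le_div_iff₀ hL0, mul_comm] at h1
    have h2 : (L * Δ) ^ η ≤ t := by
      refine (Real.rpow_le_rpow (by positivity) h1 hη.le).trans_eq ?_
      rw [← Real.rpow_mul ht0.le]
      field_simp
      simp
    rw [Real.rpow_one_add' (by positivity) (by positivity)]
    calc c₃ * (L * Δ * (L * Δ) ^ η) ≤ c₃ * (L * Δ * t) := by gcongr
      _ = _ := by rw [ht]; field_simp

section Field

variable {Ω : Type*} [MeasurableSpace Ω] {P : Measure Ω} {D : ℕ}

theorem IsIIDGaussianField.hasGaussianLaw_pair {T : Type*} {U : T → Ω → EuclideanSpace ℝ (Fin D)}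
    (hU : IsIIDGaussianField U P) (p p' : T) (j : Fin D) :
    HasGaussianLaw (fun ω => (U p ω j, U p' ω j)) P := by
  have := (hU.gaussian.hasGaussianLaw_prodMk (s := p) (t := p')).map_fun
    (((EuclideanSpace.proj j : EuclideanSpace ℝ (Fin D) →L[ℝ] ℝ).comp
      (ContinuousLinearMap.fst ℝ _ _)).prod
      ((EuclideanSpace.proj j : EuclideanSpace ℝ (Fin D) →L[ℝ] ℝ).comp
      (ContinuousLinearMap.snd ℝ _ _)))
  simpa using this

theorem IsIIDGaussianField.integral_apply {T : Type*} {U : T → Ω → EuclideanSpace ℝ (Fin D)}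
    (hU : IsIIDGaussianField U P) (p : T) (j : Fin D) :
    ∫ ω, U p ω j ∂P = (∫ ω, U p ω ∂P) j := by
  have := (EuclideanSpace.proj j : EuclideanSpace ℝ (Fin D) →L[ℝ] ℝ).integral_comp_comm
    (hU.gaussian.hasGaussianLaw_eval p).integrable
  simpa using this

theorem IsIIDGaussianField.variance_apply {T : Type*} {U : T → Ω → EuclideanSpace ℝ (Fin D)}
    (hU : IsIIDGaussianField U P) (p : T) (i j : Fin D) :
    Var[fun ω => U p ω i; P] = Var[fun ω => U p ω j; P] :=
  ((hU.ident i j).comp (measurable_pi_apply p)).variance_eq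

theorem IsIIDGaussianField.variance_sub_apply {T : Type*} {U : T → Ω → EuclideanSpace ℝ (Fin D)}
    (hU : IsIIDGaussianField U P) (p p' : T) (i j : Fin D) :
    Var[(fun ω => U p ω i) - (fun ω => U p' ω i); P] =
      Var[(fun ω => U p ω j) - (fun ω => U p' ω j); P] :=
  ((hU.ident i j).comp (u := fun g : T → ℝ => g p - g p')
    ((measurable_pi_apply p).sub (measurable_pi_apply p'))).variance_eq

theorem IsIIDGaussianField.measure_forall {T : Type*} {U : T → Ω → EuclideanSpace ℝ (Fin D)}
    (hU : IsIIDGaussianField U P) (p p' : T) (ε : ℝ) (z z' : EuclideanSpace ℝ (Fin D)) :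
    P {ω | ∀ j, |U p ω j - z j| ≤ ε ∧ |U p' ω j - z' j| ≤ ε} =
      ∏ j, P {ω | |U p ω j - z j| ≤ ε ∧ |U p' ω j - z' j| ≤ ε} := by
  have := hU.indep.measure_inter_preimage_eq_mul Finset.univ
    (sets := fun j => {g : T → ℝ | |g p - z j| ≤ ε ∧ |g p' - z' j| ≤ ε}) fun j _ => by
      rw [Set.ofPred_and]
      exact (measurableSet_le (by fun_prop) (by fun_prop)).inter
        (measurableSet_le (by fun_prop) (by fun_prop))
  refine Eq.trans ?_ this
  congr 1
  ext ω
  simp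

theorem IsIIDGaussianField.measure_forall_single {T : Type*}
    {U : T → Ω → EuclideanSpace ℝ (Fin D)}
    (hU : IsIIDGaussianField U P) (p : T) (ε : ℝ) (z : EuclideanSpace ℝ (Fin D)) :
    P {ω | ∀ j, |U p ω j - z j| ≤ ε} = ∏ j, P {ω | |U p ω j - z j| ≤ ε} := by
  simpa only [and_self] using hU.measure_forall p p ε z z

variable {d₁ d₂ : ℕ} [NeZero D]
  {S : Set (EuclideanSpace ℝ (Fin d₁) × EuclideanSpace ℝ (Fin d₂))}
  {U : EuclideanSpace ℝ (Fin d₁) × EuclideanSpace ℝ (Fin d₂) → Ω → EuclideanSpace ℝ (Fin D)}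
  {f : EuclideanSpace ℝ (Fin d₁) × EuclideanSpace ℝ (Fin d₂) → EuclideanSpace ℝ (Fin D)}
  {q₁ q₂ : ℝ → ℝ} {c₁ c₂ c₃ η k₁ k₂ k₃ : ℝ}

theorem HypU.integral_apply (h : HypU S U P f q₁ q₂ c₁ c₂ c₃ η k₁ k₂ k₃)
    (hU : IsIIDGaussianField U P) {p} (hp : p ∈ S) (j : Fin D) : ∫ ω, U p ω j ∂P = f p j := by
  rw [hU.integral_apply, h.mean p hp]

theorem HypU.variance_sub_eq (h : HypU S U P f q₁ q₂ c₁ c₂ c₃ η k₁ k₂ k₃)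
    (hU : IsIIDGaussianField U P) {p p'} (hp : p ∈ S) (hp' : p' ∈ S) :
    Var[(fun ω => U p ω 0) - (fun ω => U p' ω 0); P] =
      lpNorm (fun ω => (U p ω 0 - f p 0) - (U p' ω 0 - f p' 0)) 2 P ^ 2 := by
  have hg := hU.hasGaussianLaw_pair p p' 0
  have := hg.isProbabilityMeasure
  have hmem : MemLp (fun ω => (U p ω 0 - f p 0) - (U p' ω 0 - f p' 0)) 2 P :=
    (hg.fst.memLp_two.sub (memLp_const _)).sub (hg.snd.memLp_two.sub (memLp_const _))
  rw [lpNorm_two_sq hmem, variance_eq_integral hg.sub.aemeasurable]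
  congr 1
  ext ω
  simp only [Pi.sub_apply]
  rw [integral_sub hg.fst.integrable hg.snd.integrable, h.integral_apply hU hp,
    h.integral_apply hU hp']
  ring

/-- The variance condition of `(H_U)` involves uncentred increments, so the increment of the mean
must be accounted for. -/
theorem HypU.lpNorm_sub_sq (h : HypU S U P f q₁ q₂ c₁ c₂ c₃ η k₁ k₂ k₃)
    (hU : IsIIDGaussianField U P) {p p'} (hp : p ∈ S) (hp' : p' ∈ S) :
    lpNorm (fun ω => U p ω 0 - U p' ω 0) 2 P ^ 2 =
      Var[(fun ω => U p ω 0) - (fun ω => U p' ω 0); P] + (f p 0 - f p' 0) ^ 2 := by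
  have hg := hU.hasGaussianLaw_pair p p' 0
  have := hg.isProbabilityMeasure
  have hmem : MemLp (fun ω => U p ω 0 - U p' ω 0) 2 P := hg.fst.memLp_two.sub hg.snd.memLp_two
  rw [lpNorm_two_sq hmem,
    variance_eq_sub (hg.fst.memLp_two.sub hg.snd.memLp_two), ← h.integral_apply hU hp,
    ← h.integral_apply hU hp']
  simp only [Pi.sub_apply, Pi.pow_apply]
  rw [integral_sub hg.fst.integrable hg.snd.integrable]
  ring

/-- The variance comparison for close parameter values. -/
theorem HypU.variance_bounds (h : HypU S U P f q₁ q₂ c₁ c₂ c₃ η k₁ k₂ k₃)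
    (hU : IsIIDGaussianField U P) (hc₁ : 0 < c₁) (hc₃ : 0 < c₃)
    (hη : 0 < η) (hk₁ : 0 < k₁) (hk₂ : 0 < k₂) (hk₃ : 0 < k₃) {p p'} (hp : p ∈ S) (hp' : p' ∈ S)
    {Δ : ℝ} (hΔ : Δ = q₁ ‖p.1 - p'.1‖ + q₂ ‖p.2 - p'.2‖) (hΔ0 : 0 ≤ Δ)
    (hs₁ : k₂ * Δ ≤ √c₁) (hs₂ : c₃ * ((k₂ + k₃) * Δ) ^ (1 + η) ≤ √c₁ * (k₁ * Δ)) (j : Fin D) :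
    c₁ ≤ Var[fun ω => U p ω j; P] ∧ Var[fun ω => U p ω j; P] ≤ c₂ ∧
      c₁ ≤ Var[fun ω => U p' ω j; P] ∧
      Var[(fun ω => U p ω j) - (fun ω => U p' ω j); P] ≤ c₁ ∧
      (Var[fun ω => U p ω j; P] - Var[fun ω => U p' ω j; P]) ^ 2 ≤
        c₁ * Var[(fun ω => U p ω j) - (fun ω => U p' ω j); P] ∧
      (k₁ * Δ) ^ 2 ≤ Var[(fun ω => U p ω j) - (fun ω => U p' ω j); P] ∧
      Var[(fun ω => U p ω j) - (fun ω => U p' ω j); P] ≤ (k₂ * Δ) ^ 2 := by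
  rw [hU.variance_sub_apply p p' j 0, hU.variance_apply p j 0, hU.variance_apply p' j 0]
  have hG := h.variance_sub_eq hU hp hp'
  have hl := h.metric_lower p hp p' hp'
  have hu := h.metric_upper p hp p' hp'
  rw [← hΔ] at hl hu
  set ℓ := lpNorm (fun ω => (U p ω 0 - f p 0) - (U p' ω 0 - f p' 0)) 2 P
  have hℓ0 : 0 ≤ ℓ := lpNorm_nonneg
  have h1 : (k₁ * Δ) ^ 2 ≤ Var[(fun ω => U p ω 0) - (fun ω => U p' ω 0); P] := by
    rw [hG]; gcongr
  have h2 : Var[(fun ω => U p ω 0) - (fun ω => U p' ω 0); P] ≤ (k₂ * Δ) ^ 2 := by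
    rw [hG]; gcongr
  have hf : |f p 0 - f p' 0| ≤ k₃ * Δ := by
    rw [hΔ]
    exact (PiLp.norm_apply_le (f p - f p') 0).trans (h.mean_sub p hp p' hp')
  have hΓ := h.lpNorm_sub_sq hU hp hp'
  set Γ := lpNorm (fun ω => U p ω 0 - U p' ω 0) 2 P with hΓdef
  have hΓ0 : 0 ≤ Γ := lpNorm_nonneg
  have hΓ1 : Γ ≤ (k₂ + k₃) * Δ := by
    refine le_of_sq_le_sq ?_ (by positivity)
    rw [hΓ, ← sq_abs (f p 0 - f p' 0)]
    have : |f p 0 - f p' 0| ^ 2 ≤ (k₃ * Δ) ^ 2 := by gcongr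
    have : 0 ≤ k₂ * Δ * (k₃ * Δ) := by positivity
    nlinarith
  refine ⟨h.var_lower p hp, h.var_upper p hp, h.var_lower p' hp', ?_, ?_, h1, h2⟩
  · refine h2.trans ?_
    calc (k₂ * Δ) ^ 2 ≤ √c₁ ^ 2 := by gcongr
      _ = c₁ := Real.sq_sqrt hc₁.le
  · have h3 : |Var[fun ω => U p ω 0; P] - Var[fun ω => U p' ω 0; P]| ≤ √c₁ * (k₁ * Δ) := by
      refine (h.var_sub p hp p' hp').trans (le_trans ?_ hs₂)
      gcongr
    rw [← sq_abs]
    calc _ ≤ (√c₁ * (k₁ * Δ)) ^ 2 := by gcongr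
      _ = c₁ * (k₁ * Δ) ^ 2 := by rw [mul_pow, Real.sq_sqrt hc₁.le]
      _ ≤ _ := by gcongr

/-- The norm is at most the sum of the absolute coordinates, so some coordinate reaches the average.
-/
theorem exists_abs_apply_ge (z : EuclideanSpace ℝ (Fin D)) : ∃ j, ‖z‖ ≤ D * |z j| := by
  by_contra! hcon
  have h1 : ‖z‖ ≤ ∑ j, |z j| := by
    have h2 := (EuclideanSpace.basisFun (Fin D) ℝ).sum_repr z
    calc ‖z‖ = ‖∑ j, z j • EuclideanSpace.basisFun (Fin D) ℝ j‖ := by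
          conv_lhs => rw [← h2]
          simp
      _ ≤ ∑ j, ‖z j • EuclideanSpace.basisFun (Fin D) ℝ j‖ := norm_sum_le _ _
      _ = _ := by simp [norm_smul]
  have hD : (0 : ℝ) < D := by exact_mod_cast Nat.pos_of_ne_zero (NeZero.ne D)
  have h3 : ∑ j : Fin D, |z j| < ∑ j : Fin D, ‖z‖ / D :=
    Finset.sum_lt_sum_of_nonempty Finset.univ_nonempty fun j _ => by
      rw [lt_div_iff₀ hD]
      linarith [hcon j]
  simp only [Finset.sum_const, Finset.card_univ, Fintype.card_fin, nsmul_eq_mul] at h3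
  rw [mul_div_cancel₀ _ hD.ne'] at h3
  linarith

end Field

/-! ### Two-point and one-point estimates for the field. -/

/-- Two-point hitting estimate. -/
theorem exists_measure_two_point_le (d₁ d₂ D : ℕ) [NeZero D] {c₁ c₂ c₃ η k₁ k₂ k₃ M R : ℝ}
    (hc₁ : 0 < c₁) (hc₃ : 0 < c₃) (hη : 0 < η) (hk₁ : 0 < k₁) (hk₂ : 0 < k₂) (hk₃ : 0 < k₃)
    (hM : 0 ≤ M) (hR : 0 ≤ R) :
    ∃ C : ℝ, 0 < C ∧ ∀ (Ω : Type*) [MeasurableSpace Ω] (P : Measure Ω)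
      (S : Set (EuclideanSpace ℝ (Fin d₁) × EuclideanSpace ℝ (Fin d₂)))
      (U : EuclideanSpace ℝ (Fin d₁) × EuclideanSpace ℝ (Fin d₂) → Ω → EuclideanSpace ℝ (Fin D))
      (f : EuclideanSpace ℝ (Fin d₁) × EuclideanSpace ℝ (Fin d₂) → EuclideanSpace ℝ (Fin D))
      (q₁ q₂ : ℝ → ℝ), IsIIDGaussianField U P →
      HypU S U P f q₁ q₂ c₁ c₂ c₃ η k₁ k₂ k₃ →
      ∀ p ∈ S, ∀ p' ∈ S, ∀ (Δ ε : ℝ) (z z' : EuclideanSpace ℝ (Fin D)), Δ = q₁ ‖p.1 - p'.1‖ + q₂ ‖p.2 - p'.2‖ →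
      0 ≤ Δ → (p ≠ p' → 0 < Δ) → k₂ * Δ ≤ √c₁ →
      c₃ * ((k₂ + k₃) * Δ) ^ (1 + η) ≤ √c₁ * (k₁ * Δ) →
      0 < ε → ε ≤ 1 → ‖f p‖ ≤ M → ‖z‖ ≤ R → z ≠ z' →
      P {ω | ∀ j, |U p ω j - z j| ≤ ε ∧ |U p' ω j - z' j| ≤ ε} ≤
        ENNReal.ofReal (C * ε ^ (2 * D)) * (ENNReal.ofReal (max ‖z - z'‖ Δ) ^ D)⁻¹ := by
  obtain ⟨C, hC, hpair⟩ := exists_measure_square_le D (b := c₂) hc₁ hk₁ hk₂ hk₃.le hM hR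
  have hD : (0 : ℝ) < D := by exact_mod_cast Nat.pos_of_ne_zero (NeZero.ne D)
  have hs : 0 < √c₁ := Real.sqrt_pos.2 hc₁
  -- One summand per regime: `|z - z'| ≤ Δ`; a dominant coordinate gap of at least `4ε`; `|z - z'|`
  -- at most of order `ε`.
  refine ⟨C ^ D + (C * D) ^ D + (2 / √c₁ * (4 * D)) ^ D, by positivity, ?_⟩
  intro Ω _ P S U f q₁ q₂ hU h p hp p' hp' Δ ε z z' hΔ hΔ0 hne hs₁ hs₂ hε hε1 hfM hz hzz
  have ha : 0 < ‖z - z'‖ := norm_sub_pos_iff.2 hzz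
  have hmax : 0 < max ‖z - z'‖ Δ := lt_max_of_lt_left ha
  have x1 : (0 : ℝ) ≤ C ^ D := by positivity
  have x2 : (0 : ℝ) ≤ (C * D) ^ D := by positivity
  have x3 : (0 : ℝ) ≤ (2 / √c₁ * (4 * D)) ^ D := by positivity
  rw [← ENNReal.ofReal_pow hmax.le, ← ENNReal.ofReal_inv_of_pos (by positivity),
    ← ENNReal.ofReal_mul (by positivity)]
  have hv := h.variance_bounds hU hc₁ hc₃ hη hk₁ hk₂ hk₃ hp hp' hΔ hΔ0 hs₁ hs₂
  have hpr : ∀ j, 0 < Δ → _ := fun j hΔ' => hpair Ω P (fun ω => U p ω j) (fun ω => U p' ω j) Δ ε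
    (z j) (z' j) (hU.hasGaussianLaw_pair p p' j) hΔ' hε hε1 (hv j).1 (hv j).2.1 (hv j).2.2.1
    (hv j).2.2.2.1 (hv j).2.2.2.2.1 (hv j).2.2.2.2.2.1 (hv j).2.2.2.2.2.2
    (by rw [h.integral_apply hU hp]; exact (PiLp.norm_apply_le (f p) j).trans hfM)
    (by
      rw [h.integral_apply hU hp, h.integral_apply hU hp', hΔ]
      exact (PiLp.norm_apply_le (f p - f p') j).trans (h.mean_sub p hp p' hp'))
    ((PiLp.norm_apply_le z j).trans hz)
  rcases le_or_gt ‖z - z'‖ Δ with hc | hc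
  · have hΔ' : 0 < Δ := ha.trans_le hc
    rw [max_eq_right hc, hU.measure_forall]
    calc _ ≤ ∏ _j : Fin D, ENNReal.ofReal (C * ε ^ 2 / Δ) :=
          Finset.prod_le_prod' fun j _ => (hpr j hΔ').1
      _ = ENNReal.ofReal (C ^ D * ε ^ (2 * D) * (Δ ^ D)⁻¹) := by
          rw [Finset.prod_const, Finset.card_univ, Fintype.card_fin,
            ← ENNReal.ofReal_pow (by positivity), div_pow, mul_pow, pow_mul, div_eq_mul_inv]
      _ ≤ _ := by
          refine ENNReal.ofReal_le_ofReal ?_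
          gcongr
          linarith
  rw [max_eq_left hc.le]
  obtain ⟨j, hj⟩ := exists_abs_apply_ge (z - z')
  rw [PiLp.sub_apply] at hj
  rcases le_or_gt (4 * ε) |z j - z' j| with hzj | hzj
  -- If `p = p'`, positivity of `Δ` is not available, but a single value cannot be `ε`-close to two
  -- points `4ε` apart.
  · rcases eq_or_ne p p' with rfl | hpp
    · have : {ω | ∀ j, |U p ω j - z j| ≤ ε ∧ |U p ω j - z' j| ≤ ε} = ∅ := by
        refine Set.eq_empty_iff_forall_notMem.2 fun ω hω => ?_
        obtain ⟨h1, h2⟩ := hω j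
        have := abs_sub_le (z j) (U p ω j) (z' j)
        rw [abs_sub_comm (z j) (U p ω j)] at this
        linarith
      rw [this]
      simp
    have hΔ' := hne hpp
    have hzj0 : 0 < |z j - z' j| := by linarith
    -- Only the coordinate `j` uses the tail bound: its factor `Δ^D` cancels the `Δ^(-D)` collected
    -- from all `D` coordinates.
    rw [hU.measure_forall, ← Finset.mul_prod_erase _ _ (Finset.mem_univ j)]
    calc _ ≤ ENNReal.ofReal (C * ε ^ 2 / Δ * (Δ / |z j - z' j|) ^ D) *
          ∏ _i ∈ Finset.univ.erase j, ENNReal.ofReal (C * ε ^ 2 / Δ) :=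
          mul_le_mul' ((hpr j hΔ').2 hzj) (Finset.prod_le_prod' fun i _ => (hpr i hΔ').1)
      _ = ENNReal.ofReal ((C * ε ^ 2 / Δ) ^ D * (Δ / |z j - z' j|) ^ D) := by
          rw [Finset.prod_const, Finset.card_erase_of_mem (Finset.mem_univ j), Finset.card_univ,
            Fintype.card_fin, ← ENNReal.ofReal_pow (by positivity),
            ← ENNReal.ofReal_mul (by positivity)]
          congr 1
          rw [mul_right_comm, mul_pow_sub_one (NeZero.ne D)]
      _ ≤ ENNReal.ofReal ((C * ε ^ 2 / Δ) ^ D * (Δ * D / ‖z - z'‖) ^ D) := by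
          refine ENNReal.ofReal_le_ofReal ?_
          gcongr ?_ * ?_ ^ D
          rw [div_le_div_iff₀ hzj0 ha]
          nlinarith
      _ = ENNReal.ofReal ((C * D) ^ D * ε ^ (2 * D) * (‖z - z'‖ ^ D)⁻¹) := by
          congr 1
          rw [← mul_pow, pow_mul, ← mul_pow, ← inv_pow, ← mul_pow]
          congr 1
          field_simp
      _ ≤ _ := by
          refine ENNReal.ofReal_le_ofReal ?_
          gcongr
          linarith
  -- The second point is dropped: the remaining `ε^D` is `ε^(2D) ε^(-D)`, and `ε^(-D)` is at most of
  -- order `‖z - z'‖^(-D)`.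
  · have hlt : ‖z - z'‖ ≤ 4 * D * ε := by nlinarith
    rw [hU.measure_forall]
    calc _ ≤ ∏ _j : Fin D, ENNReal.ofReal (2 / √c₁ * ε) := by
          refine Finset.prod_le_prod' fun i _ => ?_
          have hA := (hv i).1
          refine (measure_mono (t := {ω | |U p ω i - z i| ≤ ε}) fun ω hω => hω.1).trans ?_
          refine (HasGaussianLaw.measure_abs_sub_le_le (hU.hasGaussianLaw_pair p p' i).fst
            (hc₁.trans_le hA) _ _).trans ?_
          rw [← ENNReal.ofReal_mul (by positivity)]
          refine ENNReal.ofReal_le_ofReal ?_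
          calc _ ≤ (√c₁)⁻¹ * (2 * ε) := by gcongr
            _ = _ := by ring
      _ = ENNReal.ofReal ((2 / √c₁ * ε) ^ D) := by
          rw [Finset.prod_const, Finset.card_univ, Fintype.card_fin,
            ← ENNReal.ofReal_pow (by positivity)]
      _ ≤ ENNReal.ofReal ((2 / √c₁ * (4 * D)) ^ D * ε ^ (2 * D) * (‖z - z'‖ ^ D)⁻¹) := by
          refine ENNReal.ofReal_le_ofReal ?_
          rw [pow_mul, ← mul_pow, ← inv_pow, ← mul_pow]
          gcongr ?_ ^ D
          calc 2 / √c₁ * ε = 2 / √c₁ * ε * 1 := by ring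
            _ ≤ 2 / √c₁ * ε * (4 * D * ε / ‖z - z'‖) := by
              gcongr
              exact (one_le_div ha).2 hlt
            _ = _ := by ring
      _ ≤ _ := by
          refine ENNReal.ofReal_le_ofReal ?_
          gcongr
          linarith

theorem le_gaussianPDFReal {m x L a b : ℝ} {v : NNReal} (ha : 0 < a) (hav : a ≤ v)
    (hvb : (v : ℝ) ≤ b) (hx : |x - m| ≤ L) :
    (√(2 * Real.pi * b))⁻¹ * Real.exp (-L ^ 2 / (2 * a)) ≤ gaussianPDFReal m v x := by
  have hv : (0 : ℝ) < v := ha.trans_le hav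
  rw [gaussianPDFReal]
  have h1 : (x - m) ^ 2 ≤ L ^ 2 := by
    rw [← sq_abs]
    gcongr
  refine mul_le_mul ?_ (Real.exp_le_exp.2 ?_) (Real.exp_pos _).le (by positivity)
  · have : 0 < √(2 * Real.pi * v) := Real.sqrt_pos.2 (by positivity)
    gcongr
  · rw [neg_div, neg_div]
    gcongr

/-- One-point lower hitting estimate. -/
theorem exists_le_measure_one_point (D : ℕ) [NeZero D] {c₁ c₂ M R : ℝ} (hc₁ : 0 < c₁)
    (hc₂ : 0 < c₂) :
    ∃ B : ℝ, 0 < B ∧ ∀ (Ω : Type*) [MeasurableSpace Ω] (P : Measure Ω) (T : Type*)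
      (U : T → Ω → EuclideanSpace ℝ (Fin D)), IsIIDGaussianField U P → ∀ p,
      c₁ ≤ Var[fun ω => U p ω 0; P] → Var[fun ω => U p ω 0; P] ≤ c₂ → ‖∫ ω, U p ω ∂P‖ ≤ M →
      ∀ z : EuclideanSpace ℝ (Fin D), ‖z‖ ≤ R → ∀ ε, 0 < ε → ε ≤ 1 →
      ENNReal.ofReal (B * ε ^ D) ≤ P {ω | ∀ j, |U p ω j - z j| ≤ ε} := by
  set b := (√(2 * Real.pi * c₂))⁻¹ * Real.exp (-(1 + R + M) ^ 2 / (2 * c₁)) with hb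
  have hb0 : 0 < b := by positivity
  refine ⟨(2 * b) ^ D, by positivity, fun Ω _ P T U hU p h1 h2 h3 z hz ε hε hε1 => ?_⟩
  rw [hU.measure_forall_single]
  calc ENNReal.ofReal ((2 * b) ^ D * ε ^ D) = ∏ _j : Fin D, ENNReal.ofReal (2 * b * ε) := by
        rw [Finset.prod_const, Finset.card_univ, Fintype.card_fin,
          ← ENNReal.ofReal_pow (by positivity), mul_pow (2 * b)]
    _ ≤ _ := Finset.prod_le_prod' fun j _ => ?_
  have hX := (hU.hasGaussianLaw_pair p p j).fst
  rw [hU.variance_apply p 0 j] at h1 h2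
  have hA : 0 < Var[fun ω => U p ω j; P] := hc₁.trans_le h1
  have hr : (Var[fun ω => U p ω j; P].toNNReal : ℝ) = Var[fun ω => U p ω j; P] :=
    Real.coe_toNNReal _ hA.le
  have hm : MeasurableSet {x : ℝ | |x - z j| ≤ ε} := measurableSet_le (by fun_prop) (by fun_prop)
  have := le_gaussianReal_Icc (m := ∫ ω, U p ω j ∂P) (z := z j) (ε := ε) (B := b)
    (v := Var[fun ω => U p ω j; P].toNNReal) (by simpa using hA) fun x hx => by
      refine le_gaussianPDFReal hc₁ (by rwa [hr]) (by rwa [hr]) ?_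
      have h4 : |∫ ω, U p ω j ∂P| ≤ M := by
        rw [hU.integral_apply]
        exact (PiLp.norm_apply_le _ j).trans h3
      have h5 : |z j| ≤ R := (PiLp.norm_apply_le z j).trans hz
      rw [show x - ∫ ω, U p ω j ∂P = (x - z j) + z j - ∫ ω, U p ω j ∂P by ring]
      refine (abs_sub _ _).trans (add_le_add ((abs_add_le _ _).trans (add_le_add ?_ h5)) h4)
      linarith
  rw [← hX.map_eq_gaussianReal, Measure.map_apply_of_aemeasurable hX.aemeasurable hm,
    ← ENNReal.ofReal_mul hb0.le] at this
  refine le_trans (le_of_eq ?_) this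
  congr 1
  ring

/-! ### The second moment method and the passage `ε → 0`. -/

/-- The second moment method for the measure of the random sections of a measurable set. -/
theorem sq_le_measure_mul_lintegral {Ω Y : Type*} [MeasurableSpace Ω] [MeasurableSpace Y]
    {P : Measure Ω} [IsProbabilityMeasure P] {ν : Measure Y} [SFinite ν] {B : Set (Ω × Y)}
    (hB : MeasurableSet B) {m : ℝ≥0∞} (hm : ∀ᵐ y ∂ν, m ≤ P {ω | (ω, y) ∈ B}) :
    (m * ν Set.univ) ^ 2 ≤ P {ω | ν (Prod.mk ω ⁻¹' B) ≠ 0} *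
      ∫⁻ y, ∫⁻ y', P {ω | (ω, y) ∈ B ∧ (ω, y') ∈ B} ∂ν ∂ν := by
  set Z : Ω → ℝ≥0∞ := fun ω => ν (Prod.mk ω ⁻¹' B) with hZ
  have hZm : Measurable Z := measurable_measure_prodMk_left hB
  have hH : MeasurableSet {ω | Z ω ≠ 0} := hZm (measurableSet_singleton 0).compl
  have h1 : m * ν Set.univ ≤ ∫⁻ ω, Z ω ∂P := by
    rw [hZ, ← Measure.prod_apply hB, Measure.prod_apply_symm hB, ← lintegral_const]
    exact lintegral_mono_ae hm
  have h2 : ∫⁻ ω, Z ω ^ 2 ∂P = ∫⁻ y, ∫⁻ y', P {ω | (ω, y) ∈ B ∧ (ω, y') ∈ B} ∂ν ∂ν := by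
    set B₂ : Set (Ω × (Y × Y)) := {x | (x.1, x.2.1) ∈ B ∧ (x.1, x.2.2) ∈ B} with hB₂
    have hB₂m : MeasurableSet B₂ := by
      rw [hB₂, Set.ofPred_and]
      exact ((by fun_prop : Measurable fun x : Ω × (Y × Y) => (x.1, x.2.1)) hB).inter
        ((by fun_prop : Measurable fun x : Ω × (Y × Y) => (x.1, x.2.2)) hB)
    have e1 : ∀ ω, Z ω ^ 2 = (ν.prod ν) (Prod.mk ω ⁻¹' B₂) := fun ω => by
      have : Prod.mk ω ⁻¹' B₂ = (Prod.mk ω ⁻¹' B) ×ˢ (Prod.mk ω ⁻¹' B) := rfl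
      rw [this, Measure.prod_prod, sq]
    simp_rw [e1]
    rw [← Measure.prod_apply hB₂m, Measure.prod_apply_symm hB₂m,
      lintegral_prod _ (measurable_measure_prodMk_right hB₂m).aemeasurable]
    rfl
  -- Cauchy–Schwarz applied to `1_{Z ≠ 0} · Z`.
  have h3 : ∫⁻ ω, Z ω ∂P ≤ P {ω | Z ω ≠ 0} ^ (1 / 2 : ℝ) * (∫⁻ ω, Z ω ^ 2 ∂P) ^ (1 / 2 : ℝ) := by
    have := ENNReal.lintegral_mul_le_Lp_mul_Lq P Real.HolderConjugate.two_two
      (f := {ω | Z ω ≠ 0}.indicator 1) (g := Z)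
      (measurable_one.indicator hH).aemeasurable hZm.aemeasurable
    refine le_trans (lintegral_mono fun ω => ?_) (this.trans_eq ?_)
    · by_cases h : Z ω = 0
      · simp [h]
      · simp [h]
    · congr 2
      · have : ∀ ω, ({ω | Z ω ≠ 0}.indicator (1 : Ω → ℝ≥0∞) ω) ^ (2 : ℝ) =
            {ω | Z ω ≠ 0}.indicator 1 ω := fun ω => by
          by_cases h : Z ω = 0 <;> simp [h]
        simp_rw [this]
        rw [lintegral_indicator_one hH]
      · simp
  calc (m * ν Set.univ) ^ 2 ≤
        (P {ω | Z ω ≠ 0} ^ (1 / 2 : ℝ) * (∫⁻ ω, Z ω ^ 2 ∂P) ^ (1 / 2 : ℝ)) ^ 2 := by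
        exact pow_le_pow_left₀ zero_le (h1.trans h3) 2
    _ = P {ω | Z ω ≠ 0} * ∫⁻ ω, Z ω ^ 2 ∂P := by
        rw [mul_pow, ← ENNReal.rpow_natCast, ← ENNReal.rpow_natCast, ← ENNReal.rpow_mul,
          ← ENNReal.rpow_mul]
        simp
    _ = _ := by rw [h2]

theorem measurable_gaugeInv (q : ℝ → ℝ) (r : ℝ≥0∞) : Measurable (gaugeInv q r) :=
  Monotone.measurable fun _ _ h => gaugeInv_mono h

theorem measurable_gBarKernel (d₁ d₂ D : ℕ) (q₁ q₂ : ℝ → ℝ) (r₁ r₂ : ℝ≥0∞) :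
    Measurable (gBarKernel d₁ d₂ D q₁ q₂ r₁ r₂) := by
  have h₁ := measurable_gaugeInv q₁ r₁
  have h₂ := measurable_gaugeInv q₂ r₂
  unfold gBarKernel gBar
  refine Measurable.ite (measurableSet_singleton 0) measurable_const ?_
  fun_prop

/-- The lower bound for the hitting probability of a compact set, from one-point and two-point
estimates. -/
theorem hitting_lower_bound {Ω : Type*} [MeasurableSpace Ω] {P : Measure Ω}
    [IsProbabilityMeasure P] {T : Type*} [TopologicalSpace T] [TopologicalSpace.MetrizableSpace T]
    [SecondCountableTopology T] [MeasurableSpace T] [BorelSpace T] {D : ℕ} [NeZero D]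
    {U : T → Ω → EuclideanSpace ℝ (Fin D)} (hU : ∀ p, Measurable (U p)) {τ : Measure T}
    [SFinite τ] {S : Set T} (hS : IsCompact S)
    (hcont : ∀ᵐ ω ∂P, ContinuousOn (fun p => U p ω) S)
    {K : Set (EuclideanSpace ℝ (Fin D))} (hK : IsCompact K)
    {μ : Measure (EuclideanSpace ℝ (Fin D))} [SFinite μ] (hμ : μ Kᶜ = 0)
    {g : EuclideanSpace ℝ (Fin D) → ℝ≥0∞} (hg : Measurable g) {b C : ℝ} (hC : 0 < C) (hb : 0 < b)
    (hτ : τ S ≠ ⊤) (hfin : kernelEnergy g μ ≠ ⊤)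
    (h1 : ∀ p ∈ S, ∀ z ∈ K, ∀ ε, 0 < ε → ε ≤ 1 →
      ENNReal.ofReal (b * ε ^ D) ≤ P {ω | ∀ j, |U p ω j - z j| ≤ ε})
    (h2 : ∀ p ∈ S, ∀ z ∈ K, ∀ z' ∈ K, ∀ ε, 0 < ε → ε ≤ 1 →
      ∫⁻ p' in S, P {ω | ∀ j, |U p ω j - z j| ≤ ε ∧ |U p' ω j - z' j| ≤ ε} ∂τ ≤
        ENNReal.ofReal (C * ε ^ (2 * D)) * g (z - z')) :
    (ENNReal.ofReal b * (τ S * μ Set.univ)) ^ 2 ≤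
      P {ω | ((fun p => U p ω) '' S ∩ K).Nonempty} *
        (ENNReal.ofReal C * (τ S * kernelEnergy g μ)) := by
  have hSm : MeasurableSet S := hS.isClosed.measurableSet
  set N := toMeasurable P {ω | ¬ ContinuousOn (fun p => U p ω) S} with hN
  have hNm : MeasurableSet N := measurableSet_toMeasurable _ _
  have hN0 : P N = 0 := by rw [hN, measure_toMeasurable]; exact hcont
  have hNc : ∀ ω, ω ∉ N → ContinuousOn (fun p => U p ω) S := fun ω hω => by
    by_contra hcon
    exact hω (subset_toMeasurable _ _ hcon)
  classical
  -- Off a measurable null set the paths are continuous; setting them to `0` there makes every path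
  -- of `V` continuous, hence `V` jointly measurable.
  set V : S → Ω → EuclideanSpace ℝ (Fin D) := fun p ω => if ω ∈ N then 0 else U p ω with hV
  have hVm : Measurable (Function.uncurry V) := by
    refine measurable_uncurry_of_continuous_of_measurable (fun ω => ?_) fun p =>
      Measurable.ite hNm measurable_const (hU p)
    by_cases hω : ω ∈ N
    · simpa [hV, hω] using continuous_const
    · simp only [hV, if_neg hω]
      exact (hNc ω hω).comp_continuous continuous_subtype_val fun p => p.2
  have hVU : ∀ p : S, ∀ᵐ ω ∂P, V p ω = U p ω := fun p => by
    filter_upwards [measure_eq_zero_iff_ae_notMem.1 hN0] with ω hω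
    simp [hV, hω]
  set τS : Measure S := τ.comap Subtype.val with hτS
  have hτSu : τS Set.univ = τ S := by
    rw [hτS, (MeasurableEmbedding.subtype_coe hSm).comap_apply, Set.image_univ,
      Subtype.range_coe]
  have : IsFiniteMeasure τS := ⟨by rw [hτSu]; exact hτ.lt_top⟩
  set ν : Measure (S × EuclideanSpace ℝ (Fin D)) := τS.prod μ with hν
  have hνu : ν Set.univ = τ S * μ Set.univ := by
    rw [hν, ← Set.univ_prod_univ, Measure.prod_prod, hτSu]
  have hμK : ∀ᵐ z ∂μ, z ∈ K := hμ
  have hνK : ∀ᵐ y ∂ν, y.2 ∈ K := Measure.quasiMeasurePreserving_snd.ae hμK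
  set B : ℝ → Set (Ω × (S × EuclideanSpace ℝ (Fin D))) := fun ε =>
    {x | ∀ j, |V x.2.1 x.1 j - x.2.2 j| ≤ ε} with hB
  have hBm : ∀ ε, MeasurableSet (B ε) := fun ε => by
    have hVm' : Measurable fun x : Ω × (S × EuclideanSpace ℝ (Fin D)) => V x.2.1 x.1 :=
      hVm.comp (by fun_prop : Measurable fun x : Ω × (S × EuclideanSpace ℝ (Fin D)) => (x.2.1, x.1))
    simp only [hB, Set.ofPred_forall]
    exact MeasurableSet.iInter fun j => measurableSet_le (by fun_prop) measurable_const
  have hP1 : ∀ ε (y : S × EuclideanSpace ℝ (Fin D)), P {ω | (ω, y) ∈ B ε} =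
      P {ω | ∀ j, |U y.1 ω j - y.2 j| ≤ ε} := fun ε y => by
    refine measure_congr ?_
    filter_upwards [hVU y.1] with ω hω
    refine propext ?_
    change (∀ j, |V y.1 ω j - y.2 j| ≤ ε) ↔ (∀ j, |U y.1 ω j - y.2 j| ≤ ε)
    rw [hω]
  have hP2 : ∀ ε (y y' : S × EuclideanSpace ℝ (Fin D)), P {ω | (ω, y) ∈ B ε ∧ (ω, y') ∈ B ε} =
      P {ω | ∀ j, |U y.1 ω j - y.2 j| ≤ ε ∧ |U y'.1 ω j - y'.2 j| ≤ ε} := fun ε y y' => by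
    refine measure_congr ?_
    filter_upwards [hVU y.1, hVU y'.1] with ω hω hω'
    refine propext ?_
    change ((∀ j, |V y.1 ω j - y.2 j| ≤ ε) ∧ (∀ j, |V y'.1 ω j - y'.2 j| ≤ ε)) ↔
      (∀ j, |U y.1 ω j - y.2 j| ≤ ε ∧ |U y'.1 ω j - y'.2 j| ≤ ε)
    rw [hω, hω', forall_and]
  have hE : kernelEnergy g μ = ∫⁻ z, ∫⁻ z', g (z - z') ∂μ ∂μ := by
    rw [kernelEnergy, lintegral_prod]
    exact (by fun_prop : Measurable fun z : EuclideanSpace ℝ (Fin D) × EuclideanSpace ℝ (Fin D) =>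
      g (z.1 - z.2)).aemeasurable
  have hsecond : ∀ ε, 0 < ε → ε ≤ 1 →
      ∫⁻ y, ∫⁻ y', P {ω | (ω, y) ∈ B ε ∧ (ω, y') ∈ B ε} ∂ν ∂ν ≤
        ENNReal.ofReal (C * ε ^ (2 * D)) * (τ S * kernelEnergy g μ) := by
    intro ε hε hε1
    have hin : ∀ᵐ y ∂ν, ∫⁻ y', P {ω | (ω, y) ∈ B ε ∧ (ω, y') ∈ B ε} ∂ν ≤
        ENNReal.ofReal (C * ε ^ (2 * D)) * ∫⁻ z', g (y.2 - z') ∂μ := by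
      filter_upwards [hνK] with y hy
      have hset : MeasurableSet {x : Ω × (S × EuclideanSpace ℝ (Fin D)) |
          (x.1, y) ∈ B ε ∧ (x.1, x.2) ∈ B ε} := by
        rw [Set.ofPred_and]
        exact ((by fun_prop : Measurable fun x : Ω × (S × EuclideanSpace ℝ (Fin D)) =>
          (x.1, y)) (hBm ε)).inter (hBm ε)
      have hmeas : Measurable fun y' => P {ω | (ω, y) ∈ B ε ∧ (ω, y') ∈ B ε} :=
        measurable_measure_prodMk_right hset
      rw [hν, lintegral_prod_symm _ hmeas.aemeasurable, ← lintegral_const_mul' _ _ (by simp)]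
      refine lintegral_mono_ae ?_
      filter_upwards [hμK] with z' hz'
      refine le_trans (le_of_eq ?_) (h2 y.1 y.1.2 y.2 hy z' hz' ε hε hε1)
      rw [← lintegral_subtype_comap hSm]
      exact lintegral_congr fun p' => hP2 ε y (p', z')
    refine (lintegral_mono_ae hin).trans ?_
    have hgm : Measurable fun z : EuclideanSpace ℝ (Fin D) => ∫⁻ z', g (z - z') ∂μ :=
      Measurable.lintegral_prod_right' (by fun_prop :
        Measurable fun z : EuclideanSpace ℝ (Fin D) × EuclideanSpace ℝ (Fin D) => g (z.1 - z.2))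
    have hprod := lintegral_prod (μ := τS) (ν := μ)
      (fun a : S × EuclideanSpace ℝ (Fin D) => ∫⁻ z', g (a.2 - z') ∂μ)
      (hgm.comp measurable_snd).aemeasurable
    rw [lintegral_const_mul' _ _ (by simp), hν, hprod]
    dsimp only
    rw [hE, lintegral_const, hτSu, mul_comm (τ S)]
  set H : ℝ → Set Ω := fun ε => {ω | ν (Prod.mk ω ⁻¹' B ε) ≠ 0} with hH
  have hHm : ∀ ε, MeasurableSet (H ε) := fun ε =>
    (measurable_measure_prodMk_left (hBm ε)) (measurableSet_singleton 0).compl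
  have hPH : ∀ ε, 0 < ε → ε ≤ 1 → (ENNReal.ofReal b * (τ S * μ Set.univ)) ^ 2 ≤
      P (H ε) * (ENNReal.ofReal C * (τ S * kernelEnergy g μ)) := by
    intro ε hε hε1
    have h3 := sq_le_measure_mul_lintegral (P := P) (hBm ε) (m := ENNReal.ofReal (b * ε ^ D))
      (ν := ν) (by
        filter_upwards [hνK] with y hy
        rw [hP1]
        exact h1 y.1 y.1.2 y.2 hy ε hε hε1)
    have h4 := h3.trans (mul_le_mul_right (hsecond ε hε hε1) _)
    rw [hνu, ENNReal.ofReal_mul hb.le, ENNReal.ofReal_mul hC.le] at h4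
    have h5 : ENNReal.ofReal (ε ^ (2 * D)) = ENNReal.ofReal (ε ^ D) ^ 2 := by
      rw [← ENNReal.ofReal_pow (by positivity)]
      congr 1
      ring
    rw [h5] at h4
    have h6 : ENNReal.ofReal (ε ^ D) ^ 2 ≠ 0 := pow_ne_zero _ (by simpa using pow_pos hε D)
    refine (ENNReal.mul_le_mul_iff_right h6 (by simp)).1 ?_
    calc _ = (ENNReal.ofReal b * ENNReal.ofReal (ε ^ D) * (τ S * μ Set.univ)) ^ 2 := by ring
      _ ≤ _ := h4
      _ = _ := by simp only [hH]; ring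
  -- The intersection of the `G n` is the event that `H ε` occurs for infinitely many `ε = 1 / (m +
  -- 1)`; continuity from above carries the uniform lower bound to it.
  set G : ℕ → Set Ω := fun n => ⋃ m ≥ n, H (1 / (m + 1)) with hG
  have hGm : ∀ n, MeasurableSet (G n) := fun n =>
    MeasurableSet.iUnion fun m => MeasurableSet.iUnion fun _ => hHm _
  have hGanti : Antitone G := fun n n' hnn =>
    Set.biUnion_subset_biUnion_left fun m (hm : m ≥ n') => hnn.trans hm
  have hPG : (ENNReal.ofReal b * (τ S * μ Set.univ)) ^ 2 ≤
      P (⋂ n, G n) * (ENNReal.ofReal C * (τ S * kernelEnergy g μ)) := by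
    set e := ENNReal.ofReal C * (τ S * kernelEnergy g μ)
    have h3 : ∀ n : ℕ, (ENNReal.ofReal b * (τ S * μ Set.univ)) ^ 2 / e ≤ P (G n) := fun n => by
      refine ENNReal.div_le_of_le_mul ((hPH (1 / (n + 1)) (by positivity) ?_).trans ?_)
      · rw [div_le_one (by positivity)]
        linarith [n.cast_nonneg (α := ℝ)]
      · gcongr
        exact Set.subset_biUnion_of_mem (u := fun m : ℕ => H (1 / (m + 1))) (le_refl n)
    have h4 : (ENNReal.ofReal b * (τ S * μ Set.univ)) ^ 2 / e ≤ P (⋂ n, G n) := by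
      rw [hGanti.measure_iInter (fun n => (hGm n).nullMeasurableSet) ⟨0, measure_ne_top _ _⟩]
      exact le_iInf h3
    -- Division by `e = 0` says nothing, but then `hPH` at `ε = 1` already forces the left side to
    -- vanish.
    rcases eq_or_ne e 0 with he | he
    · have := hPH 1 one_pos le_rfl
      rw [he] at this ⊢
      simpa using this
    rwa [ENNReal.div_le_iff he (ENNReal.mul_ne_top ENNReal.ofReal_ne_top
      (ENNReal.mul_ne_top hτ hfin))] at h4
  refine hPG.trans ?_
  gcongr ?_ * _
  refine measure_mono_ae ?_
  filter_upwards [measure_eq_zero_iff_ae_notMem.1 hN0] with ω hω hωG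
  change ((fun p => U p ω) '' S ∩ K).Nonempty
  by_contra hcon
  rw [Set.not_nonempty_iff_eq_empty, ← Set.disjoint_iff_inter_eq_empty] at hcon
  -- Disjoint compact sets lie at distance more than some `r > 0`, whereas coordinate gaps of at
  -- most `1 / (n + 1)` put two of their points within `D / (n + 1) < r`.
  obtain ⟨r, hr, hrK⟩ := Metric.exists_pos_forall_lt_edist (hS.image_of_continuousOn (hNc ω hω))
    hK.isClosed hcon
  have hD : (0 : ℝ) < D := by exact_mod_cast Nat.pos_of_ne_zero (NeZero.ne D)
  obtain ⟨n, hn⟩ := exists_nat_one_div_lt (show (0 : ℝ) < r / D by positivity)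
  have hωn : ω ∈ G n := Set.mem_iInter.1 hωG n
  simp only [hG, Set.mem_iUnion] at hωn
  obtain ⟨m, hmn, hωm⟩ := hωn
  have hex : ∃ y ∈ Prod.mk ω ⁻¹' B (1 / (m + 1)), y.2 ∈ K := by
    by_contra! hcon
    exact hωm (measure_mono_null hcon hνK)
  obtain ⟨y, hyB, hyK⟩ := hex
  have hy : ∀ j, |U y.1 ω j - y.2 j| ≤ 1 / (m + 1) := fun j => by
    have := hyB j
    simpa only [hV, if_neg hω] using this
  have hlt := hrK _ ⟨y.1, y.1.2, rfl⟩ _ hyK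
  obtain ⟨j, hj⟩ := exists_abs_apply_ge (U y.1 ω - y.2)
  rw [edist_dist, dist_eq_norm, ← ENNReal.ofReal_coe_nnreal,
    ENNReal.ofReal_lt_ofReal_iff_of_nonneg r.coe_nonneg] at hlt
  have h3 : (1 : ℝ) / (m + 1) ≤ 1 / (n + 1) := by
    gcongr
  rw [lt_div_iff₀ hD] at hn
  have h4 : (D : ℝ) * |(U y.1 ω - y.2) j| ≤ D * (1 / (n + 1)) := by
    gcongr
    exact (hy j).trans h3
  linarith

/-! ### From energies to capacity, and the conclusion. -/

theorem kernelEnergy_mono {E : Type*} [MeasurableSpace E] [Sub E] (k : E → ℝ≥0∞)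
    {μ μ' : Measure E} [SFinite μ] [SFinite μ'] (h : μ ≤ μ') :
    kernelEnergy k μ ≤ kernelEnergy k μ' :=
  lintegral_mono' (Measure.prod_mono h h) le_rfl

/-- A lower bound in terms of the energies of compactly supported measures gives a lower bound in
terms of the capacity. -/
theorem mul_kernelCapacity_le {E : Type*} [MeasurableSpace E] [NormedAddCommGroup E]
    [BorelSpace E] [CompleteSpace E] [SecondCountableTopology E] {k : E → ℝ≥0∞} {A : Set E}
    (hA : MeasurableSet A) {a d x : ℝ≥0∞} (hd : d ≠ 0) (hd' : d ≠ ⊤)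
    (h : ∀ K ⊆ A, IsCompact K → ∀ μ : Measure E, IsFiniteMeasure μ → μ Kᶜ = 0 →
      kernelEnergy k μ ≠ ⊤ → (a * μ Set.univ) ^ 2 ≤ x * (d * kernelEnergy k μ)) :
    (a * 2⁻¹) ^ 2 / d * kernelCapacity k A ≤ x := by
  rw [kernelCapacity]
  simp only [ENNReal.inv_iInf, ENNReal.mul_iSup]
  refine iSup_le fun μ => iSup_le fun _ => iSup_le fun hμA => ?_
  rcases eq_or_ne (kernelEnergy k μ) ⊤ with htop | htop
  · simp [htop]
  have hA1 : μ A = 1 := (prob_compl_eq_zero_iff hA).1 hμA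
  -- Inner regularity: a compact part carries more than half of `μ`, whence the factor `2⁻¹`, and
  -- restriction does not increase the energy.
  obtain ⟨K, hKA, hK, hKμ⟩ := hA.exists_lt_isCompact_of_ne_top (μ := μ) (r := 2⁻¹) (by simp)
    (by rw [hA1]; exact ENNReal.one_half_lt_one)
  have hmono : kernelEnergy k (μ.restrict K) ≤ kernelEnergy k μ :=
    kernelEnergy_mono k Measure.restrict_le_self
  have h1 := h K hKA hK (μ.restrict K) inferInstance
    (by rw [Measure.restrict_apply hK.measurableSet.compl, Set.compl_inter_self, measure_empty])
    (ne_top_of_le_ne_top htop hmono)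
  rw [Measure.restrict_apply_univ] at h1
  have h2 : (a * 2⁻¹) ^ 2 ≤ x * (d * kernelEnergy k μ) := by
    refine le_trans ?_ (h1.trans ?_)
    · gcongr
    · gcongr
  calc _ = (a * 2⁻¹) ^ 2 / (d * kernelEnergy k μ) := by
        rw [div_eq_mul_inv, div_eq_mul_inv, ENNReal.mul_inv (Or.inl hd) (Or.inl hd'), mul_assoc]
    _ ≤ x := ENNReal.div_le_of_le_mul h2

theorem diam_pos_of_volume_pos {d : ℕ} [NeZero d] {I : Set (EuclideanSpace ℝ (Fin d))}
    (hI : IsCompact I) (hvol : 0 < volume I) : 0 < Metric.diam I := by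
  refine Metric.diam_pos ?_ hI.isBounded
  by_contra h
  exact hvol.ne' ((Set.not_nontrivial_iff.1 h).measure_zero volume)

theorem theorems2
    (d₁ d₂ D : ℕ) [NeZero d₁] [NeZero d₂] [NeZero D]
    (I : Set (EuclideanSpace ℝ (Fin d₁))) (J : Set (EuclideanSpace ℝ (Fin d₂)))
    (hI : IsCompact I) (hJ : IsCompact J) (hI_vol : 0 < volume I) (hJ_vol : 0 < volume J)
    (N : ℝ) (hN : 0 < N)
    (f : EuclideanSpace ℝ (Fin d₁) × EuclideanSpace ℝ (Fin d₂) → EuclideanSpace ℝ (Fin D))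
    -- the gauge functions, whose domains contain the distances between points of `I`, `J`
    (q₁ q₂ : ℝ → ℝ) (r₁ r₂ : ℝ≥0∞) (hq₁ : IsGauge q₁ r₁) (hq₂ : IsGauge q₂ r₂)
    (hI_diam : Metric.diam I ∈ gaugeDomain r₁) (hJ_diam : Metric.diam J ∈ gaugeDomain r₂)
    -- `c = c_{I,J}` lies in the range of both gauge functions
    (c : ℝ) (hc : c = max (q₁ (Metric.diam I)) (q₂ (Metric.diam J)))
    (hc₁ : c ∈ q₁ '' gaugeDomain r₁) (hc₂ : c ∈ q₂ '' gaugeDomain r₂)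
    -- the constants in the hypotheses `(H_U)`
    (c₁ c₂ c₃ η k₁ k₂ k₃ : ℝ) (hc₁_pos : 0 < c₁) (hc₂_pos : 0 < c₂) (hc₃_pos : 0 < c₃)
    (hη : 0 < η) (hk₁ : 0 < k₁) (hk₂ : 0 < k₂) (hk₃ : 0 < k₃)
    -- the gauge functions are differentiable, with decreasing derivatives
    (hdiff₁ : ∀ x ∈ gaugeDomain r₁, 0 < x → q₁ x < c → DifferentiableAt ℝ q₁ x)
    (hdiff₂ : ∀ x ∈ gaugeDomain r₂, 0 < x → q₂ x < c → DifferentiableAt ℝ q₂ x)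
    (hanti₁ : AntitoneOn (deriv q₁) {x ∈ gaugeDomain r₁ | 0 < x ∧ x < c ∧ q₁ x < c})
    (hanti₂ : AntitoneOn (deriv q₂) {x ∈ gaugeDomain r₂ | 0 < x ∧ x < c ∧ q₂ x < c})
    -- the growth condition
    (hsup : (⨆ τ ∈ Set.Ioc 0 c,
      vBar d₁ d₂ D q₁ q₂ r₁ r₂ c (τ / 2) * gBar d₁ d₂ D q₁ q₂ r₁ r₂ τ) ∈ Set.Ioo 0 ⊤) :
    ∃ C : ℝ, 0 < C ∧
      ∀ (Ω : Type*) [MeasurableSpace Ω] (P : Measure Ω) [IsProbabilityMeasure P]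
        (U : EuclideanSpace ℝ (Fin d₁) × EuclideanSpace ℝ (Fin d₂) → Ω →
          EuclideanSpace ℝ (Fin D)),
        IsIIDGaussianField U P →
        (∀ᵐ ω ∂P, ContinuousOn (fun p => U p ω) (I ×ˢ J)) →
        HypU (I ×ˢ J) U P f q₁ q₂ c₁ c₂ c₃ η k₁ k₂ k₃ →
        ∀ A : Set (EuclideanSpace ℝ (Fin D)), MeasurableSet A → A ⊆ Metric.ball 0 N →
          ENNReal.ofReal C * kernelCapacity (gBarKernel d₁ d₂ D q₁ q₂ r₁ r₂) A ≤
            P {ω | ((fun p => U p ω) '' (I ×ˢ J) ∩ A).Nonempty} := by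
  have hcpos : 0 < c := by
    rw [hc]
    exact lt_max_of_lt_left (hq₁.apply_pos hI_diam (diam_pos_of_volume_pos hI hI_vol))
  obtain ⟨u, hu, hdist⟩ := exists_small_distance hc₁_pos hc₃_pos hη hk₁ hk₂ hk₃
  -- Each gauge stays below `u / 2`, so their sum stays below `u`; differences of points of the ball
  -- of radius `N` have norm at most `2 * N`.
  obtain ⟨I', hI'I, J', hJ'J, hI'c, hJ'c, hI'v, hJ'v, hqI, hqJ, K₀, hK₀, hloc⟩ :=
    exists_localization (D := D) hI hJ hI_vol hJ_vol hq₁ hq₂ hcpos hc₁ hc₂ hdiff₁ hdiff₂ hanti₁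
      hanti₂ hsup.2.ne (half_pos hu) (2 * N)
  obtain ⟨t₀, ht₀⟩ : I'.Nonempty := nonempty_of_measure_ne_zero hI'v.ne'
  obtain ⟨x₀, hx₀⟩ : J'.Nonempty := nonempty_of_measure_ne_zero hJ'v.ne'
  set S := I' ×ˢ J' with hS
  have hSc : IsCompact S := hI'c.prod hJ'c
  have hsub : S ⊆ I ×ˢ J := Set.prod_mono hI'I hJ'J
  have hSv : volume S ≠ 0 := by
    rw [hS, Measure.volume_eq_prod, Measure.prod_prod]
    exact mul_ne_zero hI'v.ne' hJ'v.ne'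
  have hSv' : volume S ≠ ⊤ := hSc.measure_lt_top.ne
  set M := ‖f (t₀, x₀)‖ + k₃ * u with hM
  have hM0 : 0 ≤ M := by positivity
  have hΔ : ∀ p ∈ S, ∀ p' ∈ S, 0 ≤ q₁ ‖p.1 - p'.1‖ + q₂ ‖p.2 - p'.2‖ ∧
      q₁ ‖p.1 - p'.1‖ + q₂ ‖p.2 - p'.2‖ ≤ u ∧
      (p ≠ p' → 0 < q₁ ‖p.1 - p'.1‖ + q₂ ‖p.2 - p'.2‖) := by
    intro p hp p' hp'
    obtain ⟨a1, a2, a3⟩ := hqI _ hp.1 _ hp'.1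
    obtain ⟨b1, b2, b3⟩ := hqJ _ hp.2 _ hp'.2
    refine ⟨by linarith, by linarith, fun hne => ?_⟩
    by_cases h1 : p.1 = p'.1
    · have := b2 fun h2 => hne (Prod.ext h1 h2)
      linarith
    · have := a2 h1
      linarith
  obtain ⟨C, hC, htwo⟩ := exists_measure_two_point_le d₁ d₂ D (c₂ := c₂) hc₁_pos hc₃_pos hη hk₁
    hk₂ hk₃ hM0 hN.le
  obtain ⟨b, hb, hone⟩ := exists_le_measure_one_point D (M := M) (R := N) hc₁_pos hc₂_pos
  set a : ℝ≥0∞ := ENNReal.ofReal b * volume S with ha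
  -- Adding `1` keeps the constant positive even if `K₀ = 0`. All constants are fixed before the
  -- process is introduced.
  set d : ℝ≥0∞ := ENNReal.ofReal (C * (K₀.toReal + 1)) * volume S with hd
  have hCK : 0 < C * (K₀.toReal + 1) := by positivity
  have ha0 : a ≠ 0 := mul_ne_zero (by simpa using hb) hSv
  have ha1 : a ≠ ⊤ := ENNReal.mul_ne_top (by simp) hSv'
  have hd0 : d ≠ 0 := mul_ne_zero (by simpa using hCK) hSv
  have hd1 : d ≠ ⊤ := ENNReal.mul_ne_top (by simp) hSv'
  have hfrac : (a * 2⁻¹) ^ 2 / d ≠ ⊤ := ENNReal.div_ne_top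
    (ENNReal.pow_ne_top (ENNReal.mul_ne_top ha1 (by simp))) hd0
  have hfrac0 : (a * 2⁻¹) ^ 2 / d ≠ 0 := ENNReal.div_ne_zero.2
    ⟨pow_ne_zero _ (mul_ne_zero ha0 (by simp)), hd1⟩
  refine ⟨((a * 2⁻¹) ^ 2 / d).toReal, ENNReal.toReal_pos hfrac0 hfrac, ?_⟩
  intro Ω _ P _ U hU hcont hyp A hA hAN
  rw [ENNReal.ofReal_toReal hfrac]
  refine mul_kernelCapacity_le hA hd0 hd1 fun K hKA hK μ _ hμK hfin => ?_
  have hKN : ∀ z ∈ K, ‖z‖ ≤ N := fun z hz => by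
    have := hAN (hKA hz)
    rw [mem_ball_zero_iff] at this
    exact this.le
  have hfM : ∀ p ∈ S, ‖f p‖ ≤ M := fun p hp => by
    have h1 := hyp.mean_sub p (hsub hp) (t₀, x₀) (hsub ⟨ht₀, hx₀⟩)
    have h2 : k₃ * (q₁ ‖p.1 - t₀‖ + q₂ ‖p.2 - x₀‖) ≤ k₃ * u := by
      gcongr
      exact (hΔ p hp (t₀, x₀) ⟨ht₀, hx₀⟩).2.1
    have h3 := norm_sub_norm_le (f p) (f (t₀, x₀))
    linarith
  have key := hitting_lower_bound (g := gBarKernel d₁ d₂ D q₁ q₂ r₁ r₂) (τ := volume)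
    hU.measurable hSc (hcont.mono fun ω hω => hω.mono hsub) hK hμK
    (measurable_gBarKernel d₁ d₂ D q₁ q₂ r₁ r₂) hCK hb hSv' hfin ?_ ?_
  · rw [ha, hd, mul_assoc, mul_assoc]
    refine key.trans ?_
    gcongr
  · intro p hp z hz ε hε hε1
    refine hone Ω P _ U hU p (hyp.var_lower p (hsub hp)) (hyp.var_upper p (hsub hp)) ?_ z
      (hKN z hz) ε hε hε1
    rw [hyp.mean p (hsub hp)]
    exact hfM p hp
  · intro p hp z hz z' hz' ε hε hε1
    -- On the diagonal the kernel is `∞` and the bound is trivial.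
    by_cases hzz : z = z'
    · have : 0 < C * (K₀.toReal + 1) * ε ^ (2 * D) := by positivity
      rw [hzz, sub_self, gBarKernel, if_pos rfl, ENNReal.mul_top (by simpa using this)]
      exact le_top
    have hnz : 0 < ‖z - z'‖ := norm_sub_pos_iff.2 hzz
    have hnz' : ‖z - z'‖ ≤ 2 * N := by
      have := norm_sub_le z z'
      linarith [hKN z hz, hKN z' hz']
    calc _ ≤ ∫⁻ p' in S, ENNReal.ofReal (C * ε ^ (2 * D)) *
          (ENNReal.ofReal (max ‖z - z'‖ (q₁ ‖p.1 - p'.1‖ + q₂ ‖p.2 - p'.2‖)) ^ D)⁻¹ := by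
          refine setLIntegral_mono' hSc.measurableSet fun p' hp' => ?_
          obtain ⟨e1, e2, e3⟩ := hΔ p hp p' hp'
          obtain ⟨e4, e5⟩ := hdist _ e1 e2
          exact htwo Ω P (I ×ˢ J) U f q₁ q₂ hU hyp p (hsub hp) p' (hsub hp') _ ε z z' rfl e1 e3 e4
            e5 hε hε1 (hfM p hp) (hKN z hz) hzz
      _ ≤ ENNReal.ofReal (C * ε ^ (2 * D)) *
          (K₀ * (gBar d₁ d₂ D q₁ q₂ r₁ r₂ ‖z - z'‖)⁻¹) := by
          rw [lintegral_const_mul' _ _ (by simp)]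
          gcongr
          exact hloc p hp _ hnz hnz'
      _ ≤ _ := by
          rw [gBarKernel, if_neg (sub_ne_zero.2 hzz), ← mul_assoc]
          gcongr
          rw [← ENNReal.ofReal_toReal hK₀, ← ENNReal.ofReal_mul (by positivity)]
          refine ENNReal.ofReal_le_ofReal ?_
          rw [ENNReal.toReal_ofReal ENNReal.toReal_nonneg]
          have : 0 ≤ C * ε ^ (2 * D) := by positivity
          nlinarith
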